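/- For each $n\ge1$ consider independent observations $Y_i=X_i\theta+\xi_{\eta,i}+\varepsilon_i$, $\varepsilon_i\sim N_{m_i}(0,\Delta_{\eta,i})$, $i=1,\dots,n$, with $m_i\ge1$, known $X_i\in\mathbb R^{m_i\times p}$, $\theta\in\mathbb R^p$, $p=p_n>n$, a nuisance parameter $\eta$ in a measurable space $\mathbb H$ (everything may depend on $n$), vectors $\xi_{\eta,i}\in\mathbb R^{m_i}$ and positive definite matrices $\Delta_{\eta,i}$ depending measurably on $\eta$. Write $s_\theta$ for the number of nonzero coordinates of $\theta$; $\|X\|_*$ for the largest Euclidean norm of a column of the stacked matrix $X=(X_1^T,\dots,X_n^T)^T$; $d_{B,n}^2(\eta_1,\eta_2)=n^{-1}\sum_{i}\|\Delta_{\eta_1,i}-\Delta_{\eta_2,i}\|_F^2$ and $d_n^2(\eta_1,\eta_2)=n^{-1}\sum_{i}\|\xi_{\eta_1,i}-\xi_{\eta_2,i}\|_2^2+d_{B,n}^2(\eta_1,\eta_2)$. Let $\theta_0=\theta_{0,n}$ and $\eta_0=\eta_{0,n}$ be the true parameters, $s_0=s_{\theta_0}$, and $\mathbb E_0$ the expectation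 under them. All constants are independent of $n$, and $a_n\lesssim b_n$ means $a_n\le Cb_n$ for all $n\ge 1$ with a constant $C>0$. Prior. A size $s\in\{0,\dots,p\}$ is drawn from a law $\pi_p$, then a uniformly distributed $S\subset\{1,\dots,p\}$ with $|S|=s$, then $\theta_j$, $j\in S$, independently with density $\frac\lambda2e^{-\lambda|x|}$, while $\theta_j=0$ for $j\notin S$; independently, $\eta$ is drawn from a probability law carried by a set $\mathcal H\subset\mathbb H$. The joint prior is $\Pi$, and $\Pi(\cdot\mid Y^{(n)})$ is the posterior given by Bayes' rule from the joint density of $Y^{(n)}=(Y_1,\dots,Y_n)$. For some constants $A_1,\dots,A_4,L_1,L_2,L_3>0$, $$A_1p^{-A_3}\pi_p(s-1)\le\pi_p(s)\le A_2p^{-A_4}\pi_p(s-1)\ (1\le s\le p),\qquad \lambda>0,\quad \frac{\|X\|_*}{L_1p^{L_2}}\le\lambda\le\frac{L_3\|X\|_*}{\sqrt n}.$$ Assume that there are a positive nondecreasing sequence $a_n=o(n)$ and a sequence $\bar\epsilon_n$ such that: (C1) for some $\eta'=\eta'_n\in\mathcal H$, $a_n\max_{i\le n}\|\Delta_{\eta',i}-\Delta_{\eta_0,i}\|_F^2\to0$;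 and $\max_{i\le n}\|\Delta_{\eta_1,i}-\Delta_{\eta_2,i}\|_F^2\le a_nd_{B,n}^2(\eta_1,\eta_2)$ for all $\eta_1,\eta_2\in\mathcal H$; (C2) $a_n\bar\epsilon_n^2\to0$, $n\bar\epsilon_n^2\to\infty$, and $\log\Pi(\eta\in\mathcal H:d_n(\eta,\eta_0)\le\bar\epsilon_n)\ge-Cn\bar\epsilon_n^2$ for some constant $C>0$; (C3) $\|\theta_0\|_\infty\lesssim\lambda^{-1}\log p$; (C4) the eigenvalues of $\Delta_{\eta_0,i}$, $1\le i\le n$, lie between two positive constants. Then, with $s_\star=s_0\vee(n\bar\epsilon_n^2/\log p)$, there is a constant $K_1>0$ such that $$\mathbb E_0\,\Pi(\theta:s_\theta>K_1s_\star\mid Y^{(n)})\to0.$$ -/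

import Mathlib

open MeasureTheory Filter Topology

noncomputable section

namespace SparseGaussian

/-- The Lebesgue density at `y` of the Gaussian law on `ℝᵐ` with mean `μ` and positive definite
covariance matrix `V`. -/
def gaussianDensity {m : ℕ} (μ : Fin m → ℝ) (V : Matrix (Fin m) (Fin m) ℝ) (y : Fin m → ℝ) : ℝ :=
  (Real.sqrt ((2 * Real.pi) ^ m * V.det))⁻¹ *
    Real.exp (-(1 / 2) * ((y - μ) ⬝ᵥ (V⁻¹.mulVec (y - μ))))

/-- The squared Frobenius norm of a real matrix. -/
def frobSq {k l : ℕ} (A : Matrix (Fin k) (Fin l) ℝ) : ℝ := ∑ a, ∑ b, A a b ^ 2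

/-- The number `s_θ` of nonzero coordinates of `θ`. -/
def sparsity {p : ℕ} (θ : Fin p → ℝ) : ℕ := {j | θ j ≠ 0}.ncard

/-- The high-dimensional Gaussian regression model with `n` independent observations
`Y_i = X_i θ + ξ_{η,i} + ε_i`, `ε_i ∼ N(0, Δ_{η,i})`, with `θ ∈ ℝᵖ`, `p > n`, and nuisance
parameter `η` ranging over the measurable space `ℍ`. -/
structure Model (n : ℕ) (ℍ : Type*) [MeasurableSpace ℍ] where
  /-- number of regression coefficients -/
  p : ℕ
  p_gt : n < p
  /-- dimension of the `i`-th response -/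
  m : Fin n → ℕ
  m_pos : ∀ i, 1 ≤ m i
  /-- covariates -/
  X : (i : Fin n) → Matrix (Fin (m i)) (Fin p) ℝ
  /-- nuisance part of the mean -/
  ξ : ℍ → (i : Fin n) → Fin (m i) → ℝ
  /-- covariance matrix of the errors -/
  Δ : ℍ → (i : Fin n) → Matrix (Fin (m i)) (Fin (m i)) ℝ
  posDef : ∀ η i, (Δ η i).PosDef
  measurable_ξ : ∀ i k, Measurable fun η => ξ η i k
  measurable_Δ : ∀ i k l, Measurable fun η => Δ η i k l

namespace Model

variable {n : ℕ} {ℍ : Type*} [MeasurableSpace ℍ] (M : Model n ℍ)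

/-- The space of the parameter `θ`. -/
abbrev Coef : Type := Fin M.p → ℝ

/-- The sample space of the observation vector `Y = (Y_1, …, Y_n)`. -/
abbrev Obs : Type := (i : Fin n) → Fin (M.m i) → ℝ

/-- The joint Lebesgue density of `Y` under the parameter `(θ, η)`. -/
def density (θ : M.Coef) (η : ℍ) (y : M.Obs) : ℝ :=
  ∏ i, gaussianDensity ((M.X i).mulVec θ + M.ξ η i) (M.Δ η i) (y i)

/-- The law of `Y` under the parameter `(θ, η)`. -/
def law (θ : M.Coef) (η : ℍ) : Measure M.Obs :=
  volume.withDensity fun y => ENNReal.ofReal (M.density θ η y)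

/-- `d_A²(η₁, η₂)`: average squared distance between the nuisance mean vectors. -/
def dASq (η₁ η₂ : ℍ) : ℝ := (1 / n : ℝ) * ∑ i, ∑ k, (M.ξ η₁ i k - M.ξ η₂ i k) ^ 2

/-- `d_B²(η₁, η₂)`: average squared Frobenius distance between the covariance matrices. -/
def dBSq (η₁ η₂ : ℍ) : ℝ := (1 / n : ℝ) * ∑ i, frobSq (M.Δ η₁ i - M.Δ η₂ i)

/-- The pseudo-metric `d_n = (d_A² + d_B²)^{1/2}`. -/
def d (η₁ η₂ : ℍ) : ℝ := Real.sqrt (M.dASq η₁ η₂ + M.dBSq η₁ η₂)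

/-- `‖X‖_*`: the largest Euclidean norm of a column of the stacked matrix `X`. -/
def colNorm : ℝ := ⨆ j : Fin M.p, Real.sqrt (∑ i, ∑ k, M.X i k j ^ 2)

end Model

/-- The Laplace law on `ℝ`, with density `(r / 2) exp (-r |x|)`. -/
def laplaceMeasure (r : ℝ) : Measure ℝ :=
  volume.withDensity fun x => ENNReal.ofReal (r / 2 * Real.exp (-r * |x|))

/-- The spike-and-slab law on `ℝᵖ`: draw a size `s` with probability `π s`, then a uniform subset
`S` of that size, then independent Laplace coordinates on `S`, the others being zero. -/
def spikeSlab (p : ℕ) (π : ℕ → ℝ) (r : ℝ) : Measure (Fin p → ℝ) :=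
  ∑ S : Finset (Fin p), ENNReal.ofReal (π S.card / (p.choose S.card : ℝ)) •
    Measure.pi fun j => if j ∈ S then laplaceMeasure r else Measure.dirac 0

/-- The ingredients of the prior: the law `π` on model sizes `0, …, p`, the Laplace parameter
`lam`, and a probability law for `η` carried by `H ⊆ ℍ`. -/
structure Prior (p : ℕ) (ℍ : Type*) [MeasurableSpace ℍ] where
  π : ℕ → ℝ
  π_nonneg : ∀ s, 0 ≤ π s
  π_sum : ∑ s ∈ Finset.range (p + 1), π s = 1
  lam : ℝ
  lam_pos : 0 < lam
  H : Set ℍ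
  nuisance : Measure ℍ
  isProb : IsProbabilityMeasure nuisance
  carried : ∀ᵐ η ∂nuisance, η ∈ H

/-- The joint prior of `(θ, η)`, under which `θ` and `η` are independent. -/
def Prior.joint {p : ℕ} {ℍ : Type*} [MeasurableSpace ℍ] (Q : Prior p ℍ) :
    Measure ((Fin p → ℝ) × ℍ) :=
  (spikeSlab p Q.π Q.lam).prod Q.nuisance

/-- The posterior law of `(θ, η)` given `Y = y`, by Bayes' rule. -/
def posterior {n : ℕ} {ℍ : Type*} [MeasurableSpace ℍ] (M : Model n ℍ) (Q : Prior M.p ℍ)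
    (y : M.Obs) : Measure (M.Coef × ℍ) :=
  (∫⁻ t, ENNReal.ofReal (M.density t.1 t.2 y) ∂Q.joint)⁻¹ •
    Q.joint.withDensity fun t => ENNReal.ofReal (M.density t.1 t.2 y)

section Conditions

variable {ℍ : ℕ → Type*} [∀ n, MeasurableSpace (ℍ n)]
  (M : ∀ n, Model n (ℍ n)) (Q : ∀ n, Prior (M n).p (ℍ n))

/-- The prior on model sizes decays at a polynomial rate in `p` from each size to the next. -/
def SizePriorDecay : Prop :=
  ∃ A₁ > (0 : ℝ), ∃ A₂ > (0 : ℝ), ∃ A₃ > (0 : ℝ), ∃ A₄ > (0 : ℝ),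
    ∀ n, 1 ≤ n → ∀ s, 1 ≤ s → s ≤ (M n).p →
      A₁ * ((M n).p : ℝ) ^ (-A₃) * (Q n).π (s - 1) ≤ (Q n).π s ∧
      (Q n).π s ≤ A₂ * ((M n).p : ℝ) ^ (-A₄) * (Q n).π (s - 1)

/-- The admissible range of the Laplace parameter. -/
def LaplaceRange : Prop :=
  ∃ L₁ > (0 : ℝ), ∃ L₂ > (0 : ℝ), ∃ L₃ > (0 : ℝ), ∀ n, 1 ≤ n →
    (M n).colNorm / (L₁ * ((M n).p : ℝ) ^ L₂) ≤ (Q n).lam ∧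
    (Q n).lam ≤ L₃ * (M n).colNorm / Real.sqrt n

/-- Control of the covariance matrices by a positive nondecreasing sequence `a n = o(n)`. -/
def CovarianceControl (η₀ : ∀ n, ℍ n) (a : ℕ → ℝ) : Prop :=
  (∀ n, 1 ≤ n → 0 < a n) ∧ MonotoneOn a (Set.Ici 1) ∧
  Tendsto (fun n : ℕ => a n / n) atTop (𝓝 0) ∧
  (∃ η' : ∀ n, ℍ n, (∀ n, 1 ≤ n → η' n ∈ (Q n).H) ∧
    Tendsto (fun n => a n * ⨆ i : Fin n, frobSq ((M n).Δ (η' n) i - (M n).Δ (η₀ n) i))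
      atTop (𝓝 0)) ∧
  ∀ n, 1 ≤ n → ∀ η₁ ∈ (Q n).H, ∀ η₂ ∈ (Q n).H,
    (⨆ i : Fin n, frobSq ((M n).Δ η₁ i - (M n).Δ η₂ i)) ≤ a n * (M n).dBSq η₁ η₂

/-- The prior of `η` puts enough mass near `η₀`: `log Π(d_n(η, η₀) ≤ ε n) ≥ - C n (ε n)²`,
written without the logarithm. -/
def PriorConcentration (η₀ : ∀ n, ℍ n) (a ε : ℕ → ℝ) : Prop :=
  Tendsto (fun n => a n * ε n ^ 2) atTop (𝓝 0) ∧
  Tendsto (fun n : ℕ => n * ε n ^ 2) atTop atTop ∧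
  ∃ C > (0 : ℝ), ∀ n, 1 ≤ n →
    Real.exp (-C * (n * ε n ^ 2)) ≤
      (Q n).nuisance.real {η | η ∈ (Q n).H ∧ (M n).d η (η₀ n) ≤ ε n}

/-- `‖θ₀‖_∞ ≲ log p / lam`. -/
def SignalBound (θ₀ : ∀ n, (M n).Coef) : Prop :=
  ∃ C > (0 : ℝ), ∀ n, 1 ≤ n → ∀ j,
    |θ₀ n j| ≤ C * ((Q n).lam⁻¹ * Real.log (M n).p)

/-- The eigenvalues of the true covariance matrices are bounded away from zero and infinity. -/
def EigenvalueBound (η₀ : ∀ n, ℍ n) : Prop :=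
  ∃ c > (0 : ℝ), ∃ C > (0 : ℝ), ∀ n, 1 ≤ n → ∀ i k,
    c ≤ ((M n).posDef (η₀ n) i).1.eigenvalues k ∧ ((M n).posDef (η₀ n) i).1.eigenvalues k ≤ C

/-- `s_⋆ = max (s_{θ₀}, n ε² / log p)`. -/
def sStar (θ₀ : ∀ n, (M n).Coef) (ε : ℕ → ℝ) (n : ℕ) : ℝ :=
  max (sparsity (θ₀ n) : ℝ) (n * ε n ^ 2 / Real.log (M n).p)

end Conditions

end SparseGaussian

end

/-!
The expected posterior mass of a set `T` of parameters is bounded by a comparison of prior masses.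
Write `Π` for the prior, `p_t` for the density of the sample at the parameter `t`, `p₀` for the true
density, and `Z(y) = ∫ p_t(y) dΠ(t)` for the evidence. Fix a threshold `τ > 0`. On the samples with
`τ Z ≥ p₀`, the integrand `p₀ · Π(T ∣ y) = p₀ Z⁻¹ ∫_T p_t dΠ` is at most `τ ∫_T p_t dΠ`, whose
integral over `y` is `τ Π(T)`. On the other samples it is at most `p₀`, and averaging
`p₀ ≤ s p_t + p₀² / (s p_t)` over a set `B` of parameters gives `p₀ ≤ 4 τ⁻¹ Π(B)⁻² ∫_B p₀² / p_t dΠ`.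
Hence (`lintegral_posterior_le`)

  `𝔼₀ Π(T ∣ Y) ≤ τ Π(T) + 4 X / (τ Π(B))`, where `X` bounds `∫ p₀² / p_t` on `B`.

The set `B` consists of the parameters with `‖X (θ - θ₀)‖² ≤ n ε²` and `d_n(η, η₀) ≤ ε`. Three
estimates are needed.

* `∫ p₀² / p_t ≤ exp (C n ε²)` on `B`. For two Gaussian laws this is computed in coordinates which
  diagonalize both covariance matrices (`exists_simultaneous_diagonalization`), where the integral
  is a product of one-dimensional ones (`lintegral_gaussianDensity_sq_div_le`). It is finite since
  the covariance matrices are uniformly close on `B`, by the covariance condition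
  (`eventually_frobSq_le`).
* `Π(B) ≥ π(s₀) exp (-C s_⋆ log p)`: the prior of `θ` charges a small box in the coordinate subspace
  of the support of `θ₀` (`le_spikeSlab_predSq_le`).
* `Π(s_θ > K s_⋆) ≤ 2 π(s₀) exp (-c (K - 1) s_⋆ log p)`, by the geometric decay of the prior on
  sizes (`spikeSlab_sparsity_gt_le`, `sizePrior_tail_le`).

For a large constant `K` and a suitable `τ` the bound becomes `6 exp (-s_⋆ log p)`
(`lintegral_posterior_sparsity_gt_le`), which tends to `0` because `s_⋆ log p ≥ n ε² → ∞`.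
-/

namespace SparseGaussian

open ProbabilityTheory Matrix
open scoped ENNReal NNReal

/-! ### Product integrals and one-dimensional Gaussian laws -/

/-- Tonelli's theorem for a finite product of functions of separate coordinates, which may live in
different spaces. -/
theorem lintegral_pi_prod_eq_prod {n : ℕ} {E : Fin n → Type*} [∀ i, MeasurableSpace (E i)]
    (μ : ∀ i, Measure (E i)) [∀ i, SigmaFinite (μ i)] {f : ∀ i, E i → ℝ≥0∞}
    (hf : ∀ i, Measurable (f i)) :
    ∫⁻ x, ∏ i, f i (x i) ∂Measure.pi μ = ∏ i, ∫⁻ x, f i x ∂μ i := by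
  induction n with
  | zero => simp
  | succ n ih =>
    have h := ((measurePreserving_piFinSuccAbove μ 0).symm).lintegral_comp_emb
      (MeasurableEquiv.measurableEmbedding _) (fun x => ∏ i, f i (x i))
    rw [Fin.prod_univ_succ (fun i => ∫⁻ x, f i x ∂μ i),
      ← ih (fun i => μ i.succ) (fun i => hf i.succ), ← h,
      ← lintegral_prod_mul (μ := μ 0) (ν := Measure.pi fun i => μ i.succ)
      (f := f 0) (g := fun y => ∏ i : Fin n, f i.succ (y i)) (hf 0).aemeasurable
      (Finset.measurable_prod _ fun i _ =>
      (hf i.succ).comp (measurable_pi_apply i)).aemeasurable]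
    refine lintegral_congr fun x => ?_
    rw [Fin.prod_univ_succ]
    rfl

/-- Completing the square: `φ² / N(e, d)` is a multiple of another normal density. -/
theorem gaussianPDFReal_sq_div (e : ℝ) {d : ℝ} (hd : 1 / 2 < d) (z : ℝ) :
    gaussianPDFReal 0 1 z ^ 2 / gaussianPDFReal e d.toNNReal z =
      d / √(2 * d - 1) * Real.exp (e ^ 2 / (2 * d - 1)) *
        gaussianPDFReal (-e / (2 * d - 1)) (d / (2 * d - 1)).toNNReal z := by
  have h1 : 0 < 2 * d - 1 := by linarith
  have h0 : 0 < d := by linarith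
  have hs : 0 < √(2 * d - 1) := Real.sqrt_pos.2 h1
  have hπ := Real.pi_pos
  simp only [gaussianPDFReal, NNReal.coe_one, mul_one, sub_zero,
    Real.coe_toNNReal d h0.le, Real.coe_toNNReal _ (div_pos h0 h1).le]
  have e1 : Real.exp (-z ^ 2 / 2) ^ 2 = Real.exp (e ^ 2 / (2 * d - 1)) *
      Real.exp (-(z - -e / (2 * d - 1)) ^ 2 / (2 * (d / (2 * d - 1)))) *
      Real.exp (-(z - e) ^ 2 / (2 * d)) := by
    rw [← Real.exp_nat_mul, ← Real.exp_add, ← Real.exp_add]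
    congr 1
    field_simp
    push_cast
    ring
  have e2 : √(2 * Real.pi * (d / (2 * d - 1))) = √(2 * Real.pi) * √d / √(2 * d - 1) := by
    rw [mul_div_assoc', Real.sqrt_div (by positivity), Real.sqrt_mul (by positivity)]
  have e3 : √(2 * Real.pi * d) = √(2 * Real.pi) * √d := by
    rw [Real.sqrt_mul (by positivity)]
  rw [mul_pow, e1, e2, e3]
  have h4 : 0 < √(2 * Real.pi) := Real.sqrt_pos.2 (by positivity)
  have h5 : 0 < √d := Real.sqrt_pos.2 h0
  have h6 := (Real.exp_pos (-(z - e) ^ 2 / (2 * d))).ne'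
  field_simp
  rw [Real.sq_sqrt h0.le]

theorem div_sqrt_le_exp {d : ℝ} (hd : 3 / 4 ≤ d) : d / √(2 * d - 1) ≤ Real.exp ((d - 1) ^ 2) := by
  have h1 : 1 / 2 ≤ 2 * d - 1 := by linarith
  have hs : 0 < √(2 * d - 1) := Real.sqrt_pos.2 (by linarith)
  rw [div_le_iff₀ hs]
  refine le_of_sq_le_sq ?_ (by positivity)
  rw [mul_pow, Real.sq_sqrt (by linarith), ← Real.exp_nat_mul]
  -- After squaring, `d² / (2 d - 1) = 1 + (d - 1)² / (2 d - 1) ≤ 1 + 2 (d - 1)²`.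
  have h2 := Real.add_one_le_exp (((2 : ℕ) : ℝ) * (d - 1) ^ 2)
  push_cast at h2 ⊢
  nlinarith [sq_nonneg (d - 1)]

/-- The chi-square type integral `∫ φ² / N(e, d)` in dimension one. -/
theorem lintegral_gaussianPDFReal_sq_div_le (e : ℝ) {d : ℝ} (hd : 3 / 4 ≤ d) :
    ∫⁻ z, ENNReal.ofReal (gaussianPDFReal 0 1 z ^ 2 / gaussianPDFReal e d.toNNReal z) ≤
      ENNReal.ofReal (Real.exp (2 * e ^ 2 + (d - 1) ^ 2)) := by
  have h1 : 1 / 2 ≤ 2 * d - 1 := by linarith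
  have hv : (d / (2 * d - 1)).toNNReal ≠ 0 := by
    have : 0 < d / (2 * d - 1) := div_pos (by linarith) (by linarith)
    simpa using this
  have hc : 0 ≤ d / √(2 * d - 1) * Real.exp (e ^ 2 / (2 * d - 1)) :=
    mul_nonneg (div_nonneg (by linarith) (Real.sqrt_nonneg _)) (Real.exp_pos _).le
  simp_rw [gaussianPDFReal_sq_div e (show 1 / 2 < d by linarith), ENNReal.ofReal_mul hc]
  rw [lintegral_const_mul _ (by fun_prop), lintegral_gaussianPDFReal_eq_one _ hv, mul_one]
  apply ENNReal.ofReal_le_ofReal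
  rw [add_comm, Real.exp_add]
  gcongr
  · exact div_sqrt_le_exp hd
  · rw [div_le_iff₀ (by linarith)]
    nlinarith [sq_nonneg e]

/-! ### Multivariate Gaussian densities -/

section Multivariate

variable {m : ℕ}

theorem frobSq_eq_trace (A : Matrix (Fin m) (Fin m) ℝ) : frobSq A = (A * Aᵀ).trace := by
  simp [frobSq, Matrix.trace, Matrix.mul_apply, sq]

theorem frobSq_diagonal (x : Fin m → ℝ) : frobSq (diagonal x) = ∑ k, x k ^ 2 := by
  simp [frobSq, diagonal_apply, ite_pow]

theorem frobSq_conj {U : Matrix (Fin m) (Fin m) ℝ} (hU : U * Uᵀ = 1)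
    (A : Matrix (Fin m) (Fin m) ℝ) : frobSq (Uᵀ * A * U) = frobSq A := by
  rw [frobSq_eq_trace, frobSq_eq_trace]
  calc (Uᵀ * A * U * (Uᵀ * A * U)ᵀ).trace
      = (Uᵀ * (A * (U * Uᵀ) * Aᵀ * U)).trace := by
        simp only [transpose_mul, transpose_transpose, Matrix.mul_assoc]
    _ = (A * Aᵀ).trace := by
        rw [hU, Matrix.trace_mul_comm, Matrix.mul_one, Matrix.mul_assoc _ U, hU, Matrix.mul_one]

theorem sum_sq_mulVec_of_orthogonal {U : Matrix (Fin m) (Fin m) ℝ} (hU : U * Uᵀ = 1)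
    (v : Fin m → ℝ) : ∑ k, (Uᵀ *ᵥ v) k ^ 2 = ∑ k, v k ^ 2 := by
  have h (w : Fin m → ℝ) : ∑ k, w k ^ 2 = w ⬝ᵥ w := by simp [dotProduct, sq]
  rw [h, h, dotProduct_mulVec, vecMul_transpose, mulVec_mulVec, hU, one_mulVec]

theorem frobSq_diagonal_conj_le {r : Fin m → ℝ} {c : ℝ} (hr : ∀ k, r k ^ 2 ≤ c)
    (A : Matrix (Fin m) (Fin m) ℝ) :
    frobSq (diagonal r * A * diagonal r) ≤ c ^ 2 * frobSq A := by
  simp only [frobSq, diagonal_mul, mul_diagonal, Finset.mul_sum]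
  refine Finset.sum_le_sum fun i _ => Finset.sum_le_sum fun j _ => ?_
  calc (r i * A i j * r j) ^ 2 = (r i ^ 2 * r j ^ 2) * A i j ^ 2 := by ring
    _ ≤ (c * c) * A i j ^ 2 := by
      gcongr
      · exact (sq_nonneg _).trans (hr i)
      · exact hr i
      · exact hr j
    _ = _ := by ring

theorem exists_orthogonal_diagonalization {A : Matrix (Fin m) (Fin m) ℝ} (hA : A.IsHermitian) :
    ∃ U : Matrix (Fin m) (Fin m) ℝ, U * Uᵀ = 1 ∧ Uᵀ * U = 1 ∧
      A = U * diagonal hA.eigenvalues * Uᵀ := by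
  have hs : (star (hA.eigenvectorUnitary : Matrix (Fin m) (Fin m) ℝ)) =
      (hA.eigenvectorUnitary : Matrix (Fin m) (Fin m) ℝ)ᵀ := by
    rw [star_eq_conjTranspose, conjTranspose_eq_transpose_of_trivial]
  refine ⟨hA.eigenvectorUnitary, ?_, ?_, ?_⟩
  · rw [← hs]; exact Unitary.mul_star_self_of_mem hA.eigenvectorUnitary.2
  · rw [← hs]; exact Unitary.star_mul_self_of_mem hA.eigenvectorUnitary.2
  · have h := hA.spectral_theorem
    rw [Unitary.conjStarAlgAut_apply] at h
    rw [← hs]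
    exact h

/-- Two positive definite matrices are diagonalized by one congruence `G`, with `V₀` becoming the
identity. When the eigenvalues of `V₀` are at least `c`, passing to the new coordinates costs at
most powers of `c`. -/
theorem exists_simultaneous_diagonalization {V₀ V : Matrix (Fin m) (Fin m) ℝ} (h₀ : V₀.PosDef)
    (hV : V.PosDef) {c : ℝ} (hc : 0 < c) (heig : ∀ k, c ≤ h₀.1.eigenvalues k) :
    ∃ (G : Matrix (Fin m) (Fin m) ℝ) (d : Fin m → ℝ), IsUnit G.det ∧ V₀ = G * Gᵀ ∧
      V = G * diagonal d * Gᵀ ∧ (∀ k, 0 < d k) ∧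
      ∑ k, (d k - 1) ^ 2 ≤ c⁻¹ ^ 2 * frobSq (V - V₀) ∧
      ∀ v, ∑ k, (G⁻¹ *ᵥ v) k ^ 2 ≤ c⁻¹ * ∑ k, v k ^ 2 := by
  obtain ⟨U, hU1, hU2, hU⟩ := exists_orthogonal_diagonalization h₀.1
  set l := h₀.1.eigenvalues
  have hl : ∀ k, 0 < l k := fun k => hc.trans_le (heig k)
  set r : Fin m → ℝ := fun k => √(l k)
  have hr : ∀ k, 0 < r k := fun k => Real.sqrt_pos.2 (hl k)
  set R : Matrix (Fin m) (Fin m) ℝ := diagonal r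
  set R' : Matrix (Fin m) (Fin m) ℝ := diagonal fun k => (r k)⁻¹
  have hRR : R * R = diagonal l := by
    simp only [R, diagonal_mul_diagonal]
    congr 1
    ext k
    exact Real.mul_self_sqrt (hl k).le
  have hRR' : R * R' = 1 := by
    simp only [R, R', diagonal_mul_diagonal]
    rw [← diagonal_one]
    congr 1
    ext k
    exact mul_inv_cancel₀ (hr k).ne'
  have hR'R : R' * R = 1 := mul_eq_one_comm.1 hRR'
  have hRt : Rᵀ = R := diagonal_transpose _
  have hRt' : R'ᵀ = R' := diagonal_transpose _
  -- `B` whitens `V₀`; a rotation `O` then diagonalizes `B V Bᵀ` without disturbing the identity.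
  set B := R' * Uᵀ
  have hB1 : B * (U * R) = 1 := by
    calc B * (U * R) = R' * (Uᵀ * U) * R := by simp only [B, Matrix.mul_assoc]
      _ = 1 := by rw [hU2, Matrix.mul_one, hR'R]
  have hB2 : (U * R) * B = 1 := mul_eq_one_comm.1 hB1
  have hBu : IsUnit B := IsUnit.of_mul_eq_one _ hB1
  have hC : (B * V * Bᵀ).PosDef := by
    have := hV.mul_mul_conjTranspose_same (B := B) (vecMul_injective_iff_isUnit.2 hBu)
    rwa [conjTranspose_eq_transpose_of_trivial] at this
  obtain ⟨O, hO1, hO2, hO⟩ := exists_orthogonal_diagonalization hC.1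
  set d := hC.1.eigenvalues
  have hG1 : (U * R * O) * (Oᵀ * B) = 1 := by
    calc (U * R * O) * (Oᵀ * B) = U * R * (O * Oᵀ) * B := by simp only [Matrix.mul_assoc]
      _ = 1 := by rw [hO1, Matrix.mul_one, hB2]
  have hGinv : (U * R * O)⁻¹ = Oᵀ * B := inv_eq_right_inv hG1
  have hV₀ : V₀ = U * R * O * (U * R * O)ᵀ := by
    calc V₀ = U * (R * R) * Uᵀ := by rw [hRR]; exact hU
      _ = U * R * (O * Oᵀ) * (R * Uᵀ) := by rw [hO1]; simp only [Matrix.mul_assoc, Matrix.one_mul]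
      _ = _ := by simp only [transpose_mul, hRt, Matrix.mul_assoc]
  have hVd : V = U * R * O * diagonal d * (U * R * O)ᵀ := by
    have hB2t : Bᵀ * (U * R)ᵀ = 1 := by rw [← transpose_mul, hB2, transpose_one]
    calc V = ((U * R) * B) * V * (Bᵀ * (U * R)ᵀ) := by
          rw [hB2, hB2t, Matrix.one_mul, Matrix.mul_one]
      _ = (U * R) * (B * V * Bᵀ) * (U * R)ᵀ := by simp only [Matrix.mul_assoc]
      _ = (U * R) * (O * diagonal d * Oᵀ) * (U * R)ᵀ := by rw [← hO]
      _ = _ := by rw [transpose_mul (U * R) O]; simp only [Matrix.mul_assoc]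
  refine ⟨U * R * O, d, ?_, hV₀, hVd, hC.eigenvalues_pos, ?_, ?_⟩
  · exact (Matrix.isUnit_iff_isUnit_det _).1 (IsUnit.of_mul_eq_one _ hG1)
  · have hrc : ∀ k, ((r k)⁻¹) ^ 2 ≤ c⁻¹ := fun k => by
      rw [inv_pow, Real.sq_sqrt (hl k).le]
      exact inv_anti₀ hc (heig k)
    have key : diagonal (fun k => d k - 1) = Oᵀ * (R' * (Uᵀ * (V - V₀) * U) * R') * O := by
      have hg1t : (U * R * O)ᵀ * (Oᵀ * B)ᵀ = 1 := by
        rw [← transpose_mul, mul_eq_one_comm.1 hG1, transpose_one]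
      calc diagonal (fun k => d k - 1) = diagonal d - 1 := by
            rw [← diagonal_one, diagonal_sub]
        _ = ((Oᵀ * B) * (U * R * O)) * (diagonal d - 1) * ((U * R * O)ᵀ * (Oᵀ * B)ᵀ) := by
            rw [hg1t, mul_eq_one_comm.1 hG1, Matrix.one_mul, Matrix.mul_one]
        _ = (Oᵀ * B) * (V - V₀) * (Oᵀ * B)ᵀ := by
            rw [show V - V₀ = U * R * O * (diagonal d - 1) * (U * R * O)ᵀ by
              rw [Matrix.mul_sub, Matrix.sub_mul, ← hVd, Matrix.mul_one, ← hV₀]]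
            simp only [Matrix.mul_assoc]
        _ = _ := by
            simp only [B, transpose_mul, transpose_transpose, hRt', Matrix.mul_assoc]
    rw [← frobSq_diagonal, key, frobSq_conj hO1]
    refine (frobSq_diagonal_conj_le hrc _).trans ?_
    rw [frobSq_conj hU1]
  · intro v
    rw [hGinv, ← mulVec_mulVec, sum_sq_mulVec_of_orthogonal hO1,
      ← sum_sq_mulVec_of_orthogonal hU1 v,
      Finset.mul_sum, ← mulVec_mulVec]
    refine Finset.sum_le_sum fun k _ => ?_
    rw [mulVec_diagonal, mul_pow, inv_pow, Real.sq_sqrt (hl k).le]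
    gcongr
    exact heig k

/-- In the coordinates `y = μ₀ + G z` a Gaussian density factorizes. -/
theorem gaussianDensity_comp_affine {G : Matrix (Fin m) (Fin m) ℝ} (hG : IsUnit G.det)
    {d : Fin m → ℝ} (hd : ∀ k, 0 < d k) (μ μ₀ z : Fin m → ℝ) :
    gaussianDensity μ (G * diagonal d * Gᵀ) (G *ᵥ z + μ₀) =
      |G.det|⁻¹ * ∏ k, gaussianPDFReal ((G⁻¹ *ᵥ (μ - μ₀)) k) (d k).toNNReal (z k) := by
  have hinv : (G * diagonal d * Gᵀ)⁻¹ = G⁻¹ᵀ * diagonal (fun k => (d k)⁻¹) * G⁻¹ := by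
    rw [Matrix.mul_inv_rev, Matrix.mul_inv_rev, transpose_nonsing_inv, Matrix.mul_assoc]
    congr 2
    refine inv_eq_right_inv ?_
    rw [diagonal_mul_diagonal, ← diagonal_one]
    congr 1
    ext k
    exact mul_inv_cancel₀ (hd k).ne'
  have hdet : (G * diagonal d * Gᵀ).det = |G.det| ^ 2 * ∏ k, d k := by
    rw [det_mul, det_mul, det_diagonal, det_transpose, sq_abs]
    ring
  have hvec : G⁻¹ *ᵥ (G *ᵥ z + μ₀ - μ) = z - G⁻¹ *ᵥ (μ - μ₀) := by
    rw [show G *ᵥ z + μ₀ - μ = G *ᵥ z - (μ - μ₀) by abel, mulVec_sub, mulVec_mulVec,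
      nonsing_inv_mul _ hG, one_mulVec]
  have hquad : (G *ᵥ z + μ₀ - μ) ⬝ᵥ ((G * diagonal d * Gᵀ)⁻¹ *ᵥ (G *ᵥ z + μ₀ - μ)) =
      ∑ k, (z k - (G⁻¹ *ᵥ (μ - μ₀)) k) ^ 2 / d k := by
    rw [hinv, ← mulVec_mulVec, ← mulVec_mulVec, hvec, dotProduct_mulVec, vecMul_transpose, hvec]
    simp only [dotProduct, mulVec_diagonal, Pi.sub_apply]
    refine Finset.sum_congr rfl fun k _ => ?_
    ring
  have hdet0 : 0 < |G.det| := abs_pos.2 hG.ne_zero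
  unfold gaussianDensity
  rw [hquad, hdet]
  simp only [gaussianPDFReal, Finset.prod_mul_distrib, ← Real.exp_sum, Finset.prod_inv_distrib]
  rw [← mul_assoc |G.det|⁻¹, ← mul_inv]
  congr 2
  · rw [show (2 * Real.pi) ^ m * (|G.det| ^ 2 * ∏ k, d k) =
        |G.det| ^ 2 * ∏ k, (2 * Real.pi * d k) by
      rw [Finset.prod_mul_distrib, Finset.prod_const, Finset.card_univ, Fintype.card_fin]; ring,
      Real.sqrt_mul (sq_nonneg _), Real.sqrt_sq hdet0.le, Real.sqrt_prod]
    · congr 1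
      refine Finset.prod_congr rfl fun k _ => ?_
      rw [Real.coe_toNNReal _ (hd k).le]
    · intro k _
      have := hd k
      positivity
  · rw [Finset.mul_sum]
    refine Finset.sum_congr rfl fun k _ => ?_
    rw [Real.coe_toNNReal _ (hd k).le]
    have := (hd k).ne'
    field_simp

theorem lintegral_comp_affine {G : Matrix (Fin m) (Fin m) ℝ} (hG : IsUnit G.det)
    (μ₀ : Fin m → ℝ) {f : (Fin m → ℝ) → ℝ≥0∞} (hf : Measurable f) :
    ∫⁻ y, f y = ENNReal.ofReal |G.det| * ∫⁻ z, f (G *ᵥ z + μ₀) := by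
  have h := Real.map_matrix_volume_pi_eq_smul_volume_pi (M := G) hG.ne_zero
  have hmeas : Measurable (toLin' G) :=
    (LinearMap.continuous_of_finiteDimensional (toLin' G)).measurable
  have h2 : ∫⁻ z, f (G *ᵥ z + μ₀) = ENNReal.ofReal |G.det⁻¹| * ∫⁻ y, f y := by
    rw [← lintegral_add_right_eq_self f μ₀, ← smul_eq_mul, ← lintegral_smul_measure, ← h,
      lintegral_map (by fun_prop) hmeas]
    rfl
  rw [h2, ← mul_assoc, ← ENNReal.ofReal_mul (abs_nonneg _), abs_inv,
    mul_inv_cancel₀ (abs_pos.2 hG.ne_zero).ne', ENNReal.ofReal_one, one_mul]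

theorem gaussianDensity_pos (μ : Fin m → ℝ) {V : Matrix (Fin m) (Fin m) ℝ} (hV : V.PosDef)
    (y : Fin m → ℝ) : 0 < gaussianDensity μ V y := by
  have := hV.det_pos
  unfold gaussianDensity
  positivity

theorem continuous_gaussianDensity (μ : Fin m → ℝ) (V : Matrix (Fin m) (Fin m) ℝ) :
    Continuous (gaussianDensity μ V) := by
  unfold gaussianDensity
  fun_prop

theorem lintegral_gaussianDensity (μ : Fin m → ℝ) {V : Matrix (Fin m) (Fin m) ℝ}
    (hV : V.PosDef) : ∫⁻ y, ENNReal.ofReal (gaussianDensity μ V y) = 1 := by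
  obtain ⟨c, hc, heig⟩ : ∃ c > 0, ∀ k, c ≤ hV.1.eigenvalues k := by
    rcases isEmpty_or_nonempty (Fin m) with h | h
    · exact ⟨1, one_pos, fun k => h.elim k⟩
    · obtain ⟨k, hk⟩ := Finite.exists_min hV.1.eigenvalues
      exact ⟨_, hV.eigenvalues_pos k, hk⟩
  obtain ⟨G, d, hG, -, hVd, hd, -, -⟩ := exists_simultaneous_diagonalization hV hV hc heig
  have hdet0 : 0 < |G.det| := abs_pos.2 hG.ne_zero
  rw [lintegral_comp_affine hG μ (continuous_gaussianDensity μ V).measurable.ennreal_ofReal]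
  simp_rw [hVd, gaussianDensity_comp_affine hG hd, ENNReal.ofReal_mul (inv_nonneg.2 hdet0.le),
    ENNReal.ofReal_prod_of_nonneg (fun k _ => gaussianPDFReal_nonneg _ _ _)]
  rw [lintegral_const_mul _ (by fun_prop), volume_pi, lintegral_pi_prod_eq_prod
    (f := fun k z => ENNReal.ofReal (gaussianPDFReal ((G⁻¹ *ᵥ (μ - μ)) k) (d k).toNNReal z))
    _ (fun k => by fun_prop), ← mul_assoc, ← ENNReal.ofReal_mul hdet0.le,
    mul_inv_cancel₀ hdet0.ne', ENNReal.ofReal_one, one_mul]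
  refine Finset.prod_eq_one fun k _ => lintegral_gaussianPDFReal_eq_one _ ?_
  simpa using hd k

/-- The chi-square type integral `∫ p₀² / p` of two Gaussian densities with nearby covariance
matrices is exponential in the squared distance between the parameters. -/
theorem lintegral_gaussianDensity_sq_div_le {V₀ V : Matrix (Fin m) (Fin m) ℝ} (h₀ : V₀.PosDef)
    (hV : V.PosDef) {c : ℝ} (hc : 0 < c) (heig : ∀ k, c ≤ h₀.1.eigenvalues k)
    (hnear : c⁻¹ ^ 2 * frobSq (V - V₀) ≤ 1 / 16) (μ₀ μ : Fin m → ℝ) :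
    ∫⁻ y, ENNReal.ofReal (gaussianDensity μ₀ V₀ y ^ 2 / gaussianDensity μ V y) ≤
      ENNReal.ofReal
        (Real.exp (2 * (c⁻¹ * ∑ k, (μ k - μ₀ k) ^ 2) + c⁻¹ ^ 2 * frobSq (V - V₀))) := by
  obtain ⟨G, d, hG, hV₀, hVd, hd, hd1, hv⟩ := exists_simultaneous_diagonalization h₀ hV hc heig
  have hdet0 : 0 < |G.det| := abs_pos.2 hG.ne_zero
  -- The one-dimensional integrals converge only for `d k > 1 / 2`.
  have hd34 : ∀ k, 3 / 4 ≤ d k := fun k => by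
    have h1 : (d k - 1) ^ 2 ≤ ∑ k, (d k - 1) ^ 2 :=
      Finset.single_le_sum (f := fun k => (d k - 1) ^ 2) (fun _ _ => sq_nonneg _) (Finset.mem_univ k)
    have h2 : (d k - 1) ^ 2 ≤ (1 / 4) ^ 2 := by linarith
    have := abs_le_of_sq_le_sq' h2 (by norm_num)
    linarith [this.1]
  have hmeas : Measurable fun y => ENNReal.ofReal (gaussianDensity μ₀ V₀ y ^ 2 /
      gaussianDensity μ V y) :=
    (((continuous_gaussianDensity μ₀ V₀).measurable.pow_const 2).div
      (continuous_gaussianDensity μ V).measurable).ennreal_ofReal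
  set e := G⁻¹ *ᵥ (μ - μ₀) with he
  have hratio : ∀ z, gaussianDensity μ₀ V₀ (G *ᵥ z + μ₀) ^ 2 / gaussianDensity μ V (G *ᵥ z + μ₀) =
      |G.det|⁻¹ * ∏ k, (gaussianPDFReal 0 1 (z k) ^ 2 /
        gaussianPDFReal (e k) (d k).toNNReal (z k)) := fun z => by
    have h1 : V₀ = G * diagonal (fun _ => (1 : ℝ)) * Gᵀ := by
      rw [diagonal_one, Matrix.mul_one, hV₀]
    rw [hVd, h1, gaussianDensity_comp_affine hG hd,
      gaussianDensity_comp_affine hG (fun _ => one_pos), sub_self, mulVec_zero, ← he]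
    simp only [Pi.zero_apply, Real.toNNReal_one, Finset.prod_div_distrib, Finset.prod_pow]
    have h2 : (∏ k, gaussianPDFReal (e k) (d k).toNNReal (z k)) ≠ 0 :=
      (Finset.prod_pos fun k _ => gaussianPDFReal_pos _ _ _ (by simpa using hd k)).ne'
    field_simp
  have hnn : ∀ k z, 0 ≤ gaussianPDFReal 0 1 z ^ 2 / gaussianPDFReal (e k) (d k).toNNReal z :=
    fun k z => div_nonneg (sq_nonneg _) (gaussianPDFReal_nonneg _ _ _)
  rw [lintegral_comp_affine hG μ₀ hmeas]
  simp_rw [hratio, ENNReal.ofReal_mul (inv_nonneg.2 hdet0.le),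
    ENNReal.ofReal_prod_of_nonneg (fun k _ => hnn k _)]
  rw [lintegral_const_mul _ (by fun_prop), volume_pi, lintegral_pi_prod_eq_prod
    (f := fun k z => ENNReal.ofReal (gaussianPDFReal 0 1 z ^ 2 /
      gaussianPDFReal (e k) (d k).toNNReal z))
    _ (fun k => by fun_prop), ← mul_assoc, ← ENNReal.ofReal_mul hdet0.le,
    mul_inv_cancel₀ hdet0.ne', ENNReal.ofReal_one, one_mul]
  calc ∏ k, ∫⁻ z, ENNReal.ofReal (gaussianPDFReal 0 1 z ^ 2 /
          gaussianPDFReal (e k) (d k).toNNReal z)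
      ≤ ∏ k, ENNReal.ofReal (Real.exp (2 * e k ^ 2 + (d k - 1) ^ 2)) :=
        Finset.prod_le_prod' fun k _ => lintegral_gaussianPDFReal_sq_div_le _ (hd34 k)
    _ = ENNReal.ofReal (Real.exp (2 * ∑ k, e k ^ 2 + ∑ k, (d k - 1) ^ 2)) := by
        rw [← ENNReal.ofReal_prod_of_nonneg (fun k _ => (Real.exp_pos _).le), ← Real.exp_sum,
          Finset.sum_add_distrib, Finset.mul_sum]
    _ ≤ _ := by
        gcongr
        exact hv (μ - μ₀)

end Multivariate

/-! ### Expected posterior mass in a dominated model -/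

section Posterior

variable {Θ Y : Type*} [MeasurableSpace Θ] [MeasurableSpace Y]

theorem le_add_sq_div {f p s : ℝ≥0∞} (hp : p ≠ 0) (hp' : p ≠ ∞) (hs : s ≠ 0) (hs' : s ≠ ∞) :
    f ≤ s * p + s⁻¹ * (f ^ 2 / p) := by
  rcases le_total f (s * p) with h | h
  · exact h.trans le_self_add
  · refine le_trans ?_ le_add_self
    have h1 : 1 ≤ s⁻¹ * p⁻¹ * f := by
      calc (1 : ℝ≥0∞) = s⁻¹ * p⁻¹ * (s * p) := by
            rw [mul_mul_mul_comm, ENNReal.inv_mul_cancel hs hs', ENNReal.inv_mul_cancel hp hp',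
              one_mul]
        _ ≤ _ := by gcongr
    calc f = 1 * f := (one_mul f).symm
      _ ≤ (s⁻¹ * p⁻¹ * f) * f := by gcongr
      _ = _ := by rw [div_eq_mul_inv]; ring

/-- When the evidence `∫ p dΠ` is at most `f / τ`, the number `f` is controlled by the integral of
`f² / p` over any set `B` of positive prior mass. -/
theorem le_of_evidence_lt {Pr : Measure Θ} {B : Set Θ}
    (hB0 : Pr B ≠ 0) (hB1 : Pr B ≠ ∞) {p : Θ → ℝ≥0∞} (hp : Measurable p) (hp0 : ∀ t, p t ≠ 0)
    (hp1 : ∀ t, p t ≠ ∞) {f : ℝ≥0∞} (hf : f ≠ ∞) {τ : ℝ≥0∞} (hτ0 : τ ≠ 0) (hτ1 : τ ≠ ∞)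
    (h : τ * ∫⁻ t, p t ∂Pr ≤ f) :
    f ≤ 4 * (τ⁻¹ * (Pr B)⁻¹ ^ 2 * ∫⁻ t in B, f ^ 2 / p t ∂Pr) := by
  set b := ∫⁻ t in B, f ^ 2 / p t ∂Pr
  set β := Pr B
  -- Average `f ≤ s p + f² / (s p)` over `B`, with `s` so small that the first term is absorbed.
  set s := τ * β / 2 with hs
  have hs0 : s ≠ 0 := by simp [hs, hτ0, hB0]
  have hs1 : s ≠ ∞ := by
    rw [hs]
    exact ENNReal.div_ne_top (ENNReal.mul_ne_top hτ1 hB1) two_ne_zero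
  have h1 : f * β ≤ s * (∫⁻ t, p t ∂Pr) + s⁻¹ * b := by
    calc f * β = ∫⁻ _ in B, f ∂Pr := by rw [setLIntegral_const]
      _ ≤ ∫⁻ t in B, s * p t + s⁻¹ * (f ^ 2 / p t) ∂Pr :=
        lintegral_mono fun t => le_add_sq_div (hp0 t) (hp1 t) hs0 hs1
      _ = s * (∫⁻ t in B, p t ∂Pr) + s⁻¹ * b := by
        rw [lintegral_add_left (by fun_prop), lintegral_const_mul _ hp,
          lintegral_const_mul _ (by fun_prop)]
      _ ≤ _ := by gcongr; exact Measure.restrict_le_self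
  have h2 : s * (∫⁻ t, p t ∂Pr) ≤ f * β / 2 := by
    calc s * (∫⁻ t, p t ∂Pr) = (τ * ∫⁻ t, p t ∂Pr) * β / 2 := by
          rw [hs]; simp only [div_eq_mul_inv]; ring
      _ ≤ _ := by gcongr
  have h3 : f * β / 2 ≤ s⁻¹ * b := by
    have h4 : f * β / 2 + f * β / 2 ≤ f * β / 2 + s⁻¹ * b := by
      rw [ENNReal.add_halves]
      exact h1.trans (by gcongr)
    refine (ENNReal.add_le_add_iff_left ?_).1 h4
    exact ENNReal.div_ne_top (ENNReal.mul_ne_top hf hB1) two_ne_zero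
  calc f = 2 * β⁻¹ * (f * β / 2) := by
        rw [div_eq_mul_inv]
        calc f = (2 * 2⁻¹) * (β⁻¹ * β) * f := by
              rw [ENNReal.mul_inv_cancel two_ne_zero ENNReal.ofNat_ne_top,
                ENNReal.inv_mul_cancel hB0 hB1, one_mul, one_mul]
          _ = _ := by ring
    _ ≤ 2 * β⁻¹ * (s⁻¹ * b) := by gcongr
    _ = _ := by
      rw [hs, ENNReal.inv_div (Or.inl ENNReal.ofNat_ne_top) (Or.inl two_ne_zero), div_eq_mul_inv,
        ENNReal.mul_inv (Or.inl hτ0) (Or.inl hτ1)]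
      ring

/-- Expected posterior mass of a set `T`, in a dominated model `p` under the true density `p₀`.
It is small once the prior mass of `T` is much smaller than the prior mass of a set `B` of
parameters at bounded chi-square type distance from the truth. The free threshold `τ` separates the
samples whose evidence `∫ p dΠ` exceeds `p₀ / τ` from the others. -/
theorem lintegral_posterior_le {Pr : Measure Θ} [SFinite Pr] {ν : Measure Y} [SFinite ν]
    {p : Θ → Y → ℝ≥0∞} (hp : Measurable (Function.uncurry p)) (hp0 : ∀ t y, p t y ≠ 0)
    (hp1 : ∀ t y, p t y ≠ ∞) (hpint : ∀ t, ∫⁻ y, p t y ∂ν ≤ 1)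
    {p₀ : Y → ℝ≥0∞} (hp₀ : Measurable p₀) (hp₀1 : ∀ y, p₀ y ≠ ∞)
    {B T : Set Θ} (hB : MeasurableSet B) (hB0 : Pr B ≠ 0) (hB1 : Pr B ≠ ∞) {X : ℝ≥0∞}
    (hX : ∀ᵐ t ∂Pr, t ∈ B → ∫⁻ y, p₀ y ^ 2 / p t y ∂ν ≤ X)
    {τ : ℝ≥0∞} (hτ0 : τ ≠ 0) (hτ1 : τ ≠ ∞) :
    ∫⁻ y, p₀ y * ((∫⁻ t, p t y ∂Pr)⁻¹ * ∫⁻ t in T, p t y ∂Pr) ∂ν ≤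
      τ * Pr T + 4 * (τ⁻¹ * (Pr B)⁻¹ * X) := by
  have hpy (y : Y) : Measurable fun t => p t y := hp.comp measurable_prodMk_right
  have hpt (t : Θ) : Measurable (p t) := hp.comp measurable_prodMk_left
  have hswap : Measurable (Function.uncurry fun y t => p t y) := hp.comp measurable_swap
  have hpoint : ∀ y, p₀ y * ((∫⁻ t, p t y ∂Pr)⁻¹ * ∫⁻ t in T, p t y ∂Pr) ≤
      τ * (∫⁻ t in T, p t y ∂Pr) +
        4 * (τ⁻¹ * (Pr B)⁻¹ ^ 2 * ∫⁻ t in B, p₀ y ^ 2 / p t y ∂Pr) := fun y => by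
    set Z := ∫⁻ t, p t y ∂Pr
    set N := ∫⁻ t in T, p t y ∂Pr
    have hNZ : N ≤ Z := lintegral_mono' Measure.restrict_le_self le_rfl
    rcases le_total (p₀ y) (τ * Z) with h | h
    · refine le_trans ?_ le_self_add
      -- At `Z = 0` the factor `Z⁻¹ = ∞` is harmless, since `N ≤ Z` vanishes too.
      rcases eq_or_ne Z 0 with hZ | hZ
      · simp [le_antisymm (hNZ.trans hZ.le) bot_le]
      rcases eq_or_ne Z ∞ with hZ' | hZ'
      · simp [hZ']
      calc p₀ y * (Z⁻¹ * N) ≤ τ * Z * (Z⁻¹ * N) := by gcongr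
        _ = (Z * Z⁻¹) * (τ * N) := by ring
        _ = τ * N := by rw [ENNReal.mul_inv_cancel hZ hZ', one_mul]
    · refine le_trans ?_ le_add_self
      refine le_trans ?_
        (le_of_evidence_lt hB0 hB1 (hpy y) (fun t => hp0 t y) (fun t => hp1 t y) (hp₀1 y) hτ0 hτ1 h)
      have h1 : Z⁻¹ * N ≤ 1 := by
        calc Z⁻¹ * N ≤ Z⁻¹ * Z := by gcongr
          _ ≤ 1 := ENNReal.inv_mul_le_one _
      exact mul_le_of_le_one_right' h1
  have hT : ∫⁻ y, ∫⁻ t in T, p t y ∂Pr ∂ν ≤ Pr T := by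
    rw [lintegral_lintegral_swap hswap.aemeasurable]
    calc ∫⁻ t in T, ∫⁻ y, p t y ∂ν ∂Pr ≤ ∫⁻ _ in T, 1 ∂Pr := lintegral_mono fun t => hpint t
      _ = Pr T := by simp
  have hmeasB : Measurable (Function.uncurry fun y t => p₀ y ^ 2 / p t y) :=
    ((hp₀.comp measurable_fst).pow_const 2).div hswap
  have hBX : ∫⁻ y, ∫⁻ t in B, p₀ y ^ 2 / p t y ∂Pr ∂ν ≤ X * Pr B := by
    rw [lintegral_lintegral_swap hmeasB.aemeasurable]
    calc ∫⁻ t in B, ∫⁻ y, p₀ y ^ 2 / p t y ∂ν ∂Pr ≤ ∫⁻ _ in B, X ∂Pr :=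
          lintegral_mono_ae ((ae_restrict_iff' hB).2 hX)
      _ = X * Pr B := setLIntegral_const _ _
  calc _ ≤ ∫⁻ y, τ * (∫⁻ t in T, p t y ∂Pr) +
        4 * (τ⁻¹ * (Pr B)⁻¹ ^ 2 * ∫⁻ t in B, p₀ y ^ 2 / p t y ∂Pr) ∂ν := lintegral_mono hpoint
    _ = τ * (∫⁻ y, ∫⁻ t in T, p t y ∂Pr ∂ν) +
        4 * (τ⁻¹ * (Pr B)⁻¹ ^ 2 * ∫⁻ y, ∫⁻ t in B, p₀ y ^ 2 / p t y ∂Pr ∂ν) := by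
      have m1 : Measurable fun y => ∫⁻ t in T, p t y ∂Pr := hswap.lintegral_prod_right'
      have m2 : Measurable fun y => ∫⁻ t in B, p₀ y ^ 2 / p t y ∂Pr :=
        hmeasB.lintegral_prod_right'
      rw [lintegral_add_left (by fun_prop), lintegral_const_mul _ m1,
        lintegral_const_mul _ (by fun_prop), lintegral_const_mul _ m2]
    _ ≤ τ * Pr T + 4 * (τ⁻¹ * (Pr B)⁻¹ ^ 2 * (X * Pr B)) := by gcongr
    _ = τ * Pr T + 4 * (τ⁻¹ * (Pr B)⁻¹ * X * ((Pr B)⁻¹ * Pr B)) := by ring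
    _ = _ := by rw [ENNReal.inv_mul_cancel hB0 hB1, mul_one]

end Posterior

/-! ### Density of the sample -/

section Density

variable {n : ℕ} {ℍ : Type*} [MeasurableSpace ℍ] (M : Model n ℍ)

theorem measurable_det {α : Type*} [MeasurableSpace α] {m : ℕ}
    {A : α → Matrix (Fin m) (Fin m) ℝ} (hA : ∀ k l, Measurable fun a => A a k l) :
    Measurable fun a => (A a).det := by
  simp only [Matrix.det_apply']
  fun_prop

/-- The entries of the inverse are ratios of determinants, also at singular matrices, where both
sides of Cramer's rule vanish by convention. -/
theorem measurable_inv_apply {α : Type*} [MeasurableSpace α] {m : ℕ}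
    {A : α → Matrix (Fin m) (Fin m) ℝ} (hA : ∀ k l, Measurable fun a => A a k l) (k l : Fin m) :
    Measurable fun a => (A a)⁻¹ k l := by
  have h : ∀ a, (A a)⁻¹ k l = (A a).det⁻¹ * ((A a).updateRow l (Pi.single k 1)).det := fun a => by
    rw [Matrix.inv_def, Ring.inverse_eq_inv', Matrix.smul_apply, adjugate_apply, smul_eq_mul]
  simp only [h]
  refine (measurable_det hA).inv.mul (measurable_det fun i j => ?_)
  by_cases hi : i = l
  · simp [hi]
  · simpa [updateRow_apply, hi] using hA i j

theorem Model.measurable_density :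
    Measurable fun q : (M.Coef × ℍ) × M.Obs => M.density q.1.1 q.1.2 q.2 := by
  unfold Model.density gaussianDensity
  refine Finset.measurable_prod _ fun i _ => ?_
  have hΔ : ∀ k l, Measurable fun q : (M.Coef × ℍ) × M.Obs => M.Δ q.1.2 i k l := fun k l =>
    (M.measurable_Δ i k l).comp (by fun_prop)
  have hξ : ∀ k, Measurable fun q : (M.Coef × ℍ) × M.Obs => M.ξ q.1.2 i k := fun k =>
    (M.measurable_ξ i k).comp (by fun_prop)
  have h1 := measurable_det hΔ
  have h2 := measurable_inv_apply hΔ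
  have h3 : ∀ k, Measurable fun q : (M.Coef × ℍ) × M.Obs =>
      (q.2 i - ((M.X i).mulVec q.1.1 + M.ξ q.1.2 i)) k := fun k => by
    simp only [Pi.sub_apply, Pi.add_apply, Matrix.mulVec, dotProduct]
    have := hξ k
    fun_prop
  have h4 : Measurable fun q : (M.Coef × ℍ) × M.Obs =>
      (q.2 i - ((M.X i).mulVec q.1.1 + M.ξ q.1.2 i)) ⬝ᵥ
        ((M.Δ q.1.2 i)⁻¹ *ᵥ (q.2 i - ((M.X i).mulVec q.1.1 + M.ξ q.1.2 i))) := by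
    simp only [dotProduct, Matrix.mulVec]
    exact Finset.measurable_sum _ fun k _ => (h3 k).mul
      (Finset.measurable_sum _ fun l _ => (h2 k l).mul (h3 l))
  fun_prop

theorem Model.density_pos (θ : M.Coef) (η : ℍ) (y : M.Obs) : 0 < M.density θ η y :=
  Finset.prod_pos fun i _ => gaussianDensity_pos _ (M.posDef η i) _

theorem Model.lintegral_density (θ : M.Coef) (η : ℍ) :
    ∫⁻ y, ENNReal.ofReal (M.density θ η y) = 1 := by
  unfold Model.density
  simp_rw [ENNReal.ofReal_prod_of_nonneg (fun i _ => (gaussianDensity_pos _ (M.posDef η i) _).le)]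
  rw [volume_pi, lintegral_pi_prod_eq_prod (f := fun i y => ENNReal.ofReal
    (gaussianDensity ((M.X i).mulVec θ + M.ξ η i) (M.Δ η i) y)) _
    (fun i => (continuous_gaussianDensity _ _).measurable.ennreal_ofReal)]
  exact Finset.prod_eq_one fun i _ => lintegral_gaussianDensity _ (M.posDef η i)

/-- The squared norm of `X (θ - θ₀)`, for the stacked matrix `X`. -/
def Model.predSq (θ θ₀ : M.Coef) : ℝ := ∑ i, ∑ k, ((M.X i).mulVec (θ - θ₀)) k ^ 2

/-- Chi-square type bound for the whole sample. -/
theorem Model.lintegral_density_sq_div_le {c r : ℝ} (hc : 0 < c) (θ₀ θ : M.Coef) (η₀ η : ℍ)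
    (heig : ∀ i k, c ≤ (M.posDef η₀ i).1.eigenvalues k)
    (hnear : ∀ i, c⁻¹ ^ 2 * frobSq (M.Δ η i - M.Δ η₀ i) ≤ 1 / 16)
    (hθ : M.predSq θ θ₀ ≤ r) (hη : n * (M.dASq η η₀ + M.dBSq η η₀) ≤ r) :
    ∫⁻ y, ENNReal.ofReal (M.density θ₀ η₀ y) ^ 2 / ENNReal.ofReal (M.density θ η y) ≤
      ENNReal.ofReal (Real.exp ((8 * c⁻¹ + c⁻¹ ^ 2) * r)) := by
  have hpos := fun θ η i y => gaussianDensity_pos ((M.X i).mulVec θ + M.ξ η i) (M.posDef η i) y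
  have hn : ∀ S : ℝ, (n : ℝ) * ((1 / n : ℝ) * S) = S ∨ n = 0 := fun S => by
    rcases eq_or_ne n 0 with h | h
    · exact Or.inr h
    · left; field_simp
  have hratio : ∀ y, ENNReal.ofReal (M.density θ₀ η₀ y) ^ 2 / ENNReal.ofReal (M.density θ η y) =
      ∏ i, ENNReal.ofReal
        (gaussianDensity ((M.X i).mulVec θ₀ + M.ξ η₀ i) (M.Δ η₀ i) (y i) ^ 2 /
          gaussianDensity ((M.X i).mulVec θ + M.ξ η i) (M.Δ η i) (y i)) := fun y => by
    rw [← ENNReal.ofReal_pow (M.density_pos _ _ _).le, ← ENNReal.ofReal_div_of_pos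
      (M.density_pos _ _ _), ← ENNReal.ofReal_prod_of_nonneg
      (fun i _ => div_nonneg (sq_nonneg _) (hpos _ _ _ _).le), Finset.prod_div_distrib,
      Finset.prod_pow]
    rfl
  simp_rw [hratio]
  rw [volume_pi, lintegral_pi_prod_eq_prod (f := fun i y => ENNReal.ofReal
    (gaussianDensity ((M.X i).mulVec θ₀ + M.ξ η₀ i) (M.Δ η₀ i) y ^ 2 /
          gaussianDensity ((M.X i).mulVec θ + M.ξ η i) (M.Δ η i) y)) _
    (fun i => (((continuous_gaussianDensity _ _).measurable.pow_const 2).div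
      (continuous_gaussianDensity _ _).measurable).ennreal_ofReal)]
  refine (Finset.prod_le_prod' fun i _ => lintegral_gaussianDensity_sq_div_le (M.posDef η₀ i)
    (M.posDef η i) hc (heig i) (hnear i) _ _).trans ?_
  rw [← ENNReal.ofReal_prod_of_nonneg (fun i _ => (Real.exp_pos _).le), ← Real.exp_sum]
  apply ENNReal.ofReal_le_ofReal
  apply Real.exp_le_exp.2
  rw [Finset.sum_add_distrib, ← Finset.mul_sum, ← Finset.mul_sum, ← Finset.mul_sum]
  have hA : 0 ≤ n * M.dASq η η₀ := by
    unfold Model.dASq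
    positivity
  have hB : 0 ≤ n * M.dBSq η η₀ := by
    unfold Model.dBSq frobSq
    positivity
  have hA' : ∑ i, ∑ k, (M.ξ η i k - M.ξ η₀ i k) ^ 2 ≤ n * M.dASq η η₀ := by
    rcases hn (∑ i, ∑ k, (M.ξ η i k - M.ξ η₀ i k) ^ 2) with h | h
    · exact h.ge
    · subst h; simp
  have hB' : ∑ i, frobSq (M.Δ η i - M.Δ η₀ i) ≤ n * M.dBSq η η₀ := by
    rcases hn (∑ i, frobSq (M.Δ η i - M.Δ η₀ i)) with h | h
    · exact h.ge
    · subst h; simp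
  have hmean : ∑ i, ∑ k, (((M.X i).mulVec θ + M.ξ η i) k - ((M.X i).mulVec θ₀ + M.ξ η₀ i) k) ^ 2 ≤
      2 * M.predSq θ θ₀ + 2 * ∑ i, ∑ k, (M.ξ η i k - M.ξ η₀ i k) ^ 2 := by
    unfold Model.predSq
    simp only [Finset.mul_sum, ← Finset.sum_add_distrib]
    refine Finset.sum_le_sum fun i _ => Finset.sum_le_sum fun k _ => ?_
    rw [Matrix.mulVec_sub, Pi.sub_apply, Pi.add_apply, Pi.add_apply]
    nlinarith [sq_nonneg ((((M.X i).mulVec θ) k - ((M.X i).mulVec θ₀) k) -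
      (M.ξ η i k - M.ξ η₀ i k))]
  have hc1 : 0 < c⁻¹ := inv_pos.2 hc
  calc _ ≤ 2 * (c⁻¹ * (4 * r)) + c⁻¹ ^ 2 * r := by
        gcongr
        · linarith
        · linarith
    _ = _ := by ring

/-- Passage from the posterior and the law of the sample to their densities, the form to which
`lintegral_posterior_le` applies. -/
theorem lintegral_law_posterior_le {Q : Prior M.p ℍ} [SFinite Q.joint] (θ₀ : M.Coef) (η₀ : ℍ)
    {T : Set (M.Coef × ℍ)} (hT : MeasurableSet T) :
    ∫⁻ y, posterior M Q y T ∂M.law θ₀ η₀ ≤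
      ∫⁻ y, ENNReal.ofReal (M.density θ₀ η₀ y) *
        ((∫⁻ t, ENNReal.ofReal (M.density t.1 t.2 y) ∂Q.joint)⁻¹ *
          ∫⁻ t in T, ENNReal.ofReal (M.density t.1 t.2 y) ∂Q.joint) := by
  unfold Model.law
  have h : Measurable fun y : M.Obs => ENNReal.ofReal (M.density θ₀ η₀ y) :=
    (M.measurable_density.comp (measurable_prodMk_left (x := (θ₀, η₀)))).ennreal_ofReal
  refine (lintegral_withDensity_le_lintegral_mul _ h _).trans_eq ?_
  refine lintegral_congr fun y => ?_
  simp only [Pi.mul_apply, posterior, Measure.smul_apply, smul_eq_mul, withDensity_apply _ hT]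

end Density

/-! ### The spike-and-slab prior -/

section Prior

theorem isProbabilityMeasure_laplaceMeasure {r : ℝ} (hr : 0 < r) :
    IsProbabilityMeasure (laplaceMeasure r) := by
  constructor
  have h : ∫ x : ℝ, r / 2 * Real.exp (-r * |x|) = 1 := by
    rw [integral_comp_abs (f := fun x => r / 2 * Real.exp (-r * x)), integral_const_mul,
      integral_exp_mul_Ioi (by linarith)]
    simp
    field_simp
  have hint : Integrable fun x : ℝ => r / 2 * Real.exp (-r * |x|) := by
    by_contra hc
    rw [integral_undef hc] at h
    exact zero_ne_one h
  rw [laplaceMeasure, withDensity_apply _ MeasurableSet.univ, Measure.restrict_univ,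
    ← ofReal_integral_eq_lintegral_ofReal hint (ae_of_all _ fun x => by positivity), h,
    ENNReal.ofReal_one]

theorem le_laplaceMeasure_Icc {r ρ : ℝ} (hr : 0 < r) (x : ℝ) :
    ENNReal.ofReal (ρ * Real.exp (-(r * |x|) - ρ)) ≤
      laplaceMeasure r (Set.Icc (x - ρ / r) (x + ρ / r)) := by
  rw [laplaceMeasure, withDensity_apply _ measurableSet_Icc]
  calc ENNReal.ofReal (ρ * Real.exp (-(r * |x|) - ρ))
      = ∫⁻ _ in Set.Icc (x - ρ / r) (x + ρ / r),
          ENNReal.ofReal (r / 2 * Real.exp (-(r * |x|) - ρ)) := by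
        rw [setLIntegral_const, Real.volume_Icc, ← ENNReal.ofReal_mul (by positivity)]
        congr 1
        field_simp
        ring
    _ ≤ _ := by
        refine setLIntegral_mono' measurableSet_Icc fun y hy => ?_
        gcongr
        have h1 : |y| ≤ |x| + ρ / r := by
          have h2 : |y - x| ≤ ρ / r := abs_le.2 ⟨by linarith [hy.1], by linarith [hy.2]⟩
          have h3 := abs_add_le (y - x) x
          rw [sub_add_cancel] at h3
          linarith
        have h4 : r * |y| ≤ r * |x| + ρ := by
          calc r * |y| ≤ r * (|x| + ρ / r) := by gcongr
            _ = r * |x| + ρ := by field_simp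
        linarith

variable {p : ℕ}

theorem sparsity_eq_card (θ : Fin p → ℝ) :
    sparsity θ = (Finset.univ.filter fun j => θ j ≠ 0).card := by
  rw [sparsity, ← Set.ncard_coe_finset]
  simp

theorem sparsity_le (θ : Fin p → ℝ) : sparsity θ ≤ p := by
  rw [sparsity_eq_card]
  exact (Finset.card_le_univ _).trans_eq (Fintype.card_fin p)

theorem measurable_sparsity : Measurable fun θ : Fin p → ℝ => (sparsity θ : ℝ) := by
  have h : ∀ θ : Fin p → ℝ, (sparsity θ : ℝ) = ∑ j, if θ j = 0 then 0 else 1 := fun θ => by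
    rw [sparsity_eq_card, Finset.card_filter]
    push_cast
    exact Finset.sum_congr rfl fun j _ => by by_cases h : θ j = 0 <;> simp [h]
  simp only [h]
  exact Finset.measurable_sum _ fun j _ => Measurable.ite
    ((measurableSet_singleton (0 : ℝ)).preimage (measurable_pi_apply j))
    measurable_const measurable_const

theorem isProbabilityMeasure_slab {r : ℝ} (hr : 0 < r) (S : Finset (Fin p)) (j : Fin p) :
    IsProbabilityMeasure (if j ∈ S then laplaceMeasure r else Measure.dirac 0) := by
  have := isProbabilityMeasure_laplaceMeasure hr
  split_ifs <;> infer_instance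

theorem isFiniteMeasure_spikeSlab (π : ℕ → ℝ) {r : ℝ} (hr : 0 < r) :
    IsFiniteMeasure (spikeSlab p π r) := by
  have := isProbabilityMeasure_slab (p := p) hr
  constructor
  simp only [spikeSlab, Measure.coe_finsetSum, Finset.sum_apply, Measure.smul_apply, measure_univ,
    smul_eq_mul, mul_one]
  exact ENNReal.sum_lt_top.2 fun _ _ => ENNReal.ofReal_lt_top

/-- Prior mass of a box around `θ₀` inside the coordinate subspace of its support. -/
theorem le_spikeSlab_box (π : ℕ → ℝ) {r ρ : ℝ} (hr : 0 < r) (hρ : 0 ≤ ρ) (θ₀ : Fin p → ℝ)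
    (hπ : 0 ≤ π (sparsity θ₀)) :
    ENNReal.ofReal (π (sparsity θ₀) / p.choose (sparsity θ₀) *
      ∏ j with θ₀ j ≠ 0, ρ * Real.exp (-(r * |θ₀ j|) - ρ)) ≤
      spikeSlab p π r {θ | ∀ j, |θ j - θ₀ j| ≤ if θ₀ j ≠ 0 then ρ / r else 0} := by
  have := isProbabilityMeasure_slab (p := p) hr
  set S : Finset (Fin p) := Finset.univ.filter fun j => θ₀ j ≠ 0 with hS
  rw [sparsity_eq_card] at hπ ⊢
  set A : Fin p → Set ℝ := fun j => if j ∈ S then Set.Icc (θ₀ j - ρ / r) (θ₀ j + ρ / r) else {0}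
  have hA : {θ : Fin p → ℝ | ∀ j, |θ j - θ₀ j| ≤ if θ₀ j ≠ 0 then ρ / r else 0} =
      Set.univ.pi A := by
    ext θ
    simp only [Set.mem_ofPred_eq, Set.mem_univ_pi, A]
    refine forall_congr' fun j => ?_
    by_cases hj : θ₀ j = 0
    · simp [hS, hj]
    · have : j ∈ S := by simp [hS, hj]
      simp only [this, if_true, ne_eq, hj, not_false_iff, Set.mem_Icc, abs_le]
      constructor <;> rintro ⟨h1, h2⟩ <;> constructor <;> linarith
  have hpi : ENNReal.ofReal (∏ j ∈ S, ρ * Real.exp (-(r * |θ₀ j|) - ρ)) ≤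
      Measure.pi (fun j => if j ∈ S then laplaceMeasure r else Measure.dirac 0) (Set.univ.pi A) := by
    rw [Measure.pi_pi, ENNReal.ofReal_prod_of_nonneg (fun j _ => by positivity),
      ← Finset.prod_subset (Finset.subset_univ S)]
    · refine Finset.prod_le_prod' fun j hj => ?_
      simp only [A, hj, if_true]
      exact le_laplaceMeasure_Icc hr _
    · intro j _ hj
      simp [A, hj]
  rw [hA, spikeSlab, Measure.coe_finsetSum, Finset.sum_apply]
  refine le_trans ?_ (Finset.single_le_sum (fun _ _ => bot_le) (Finset.mem_univ S))
  rw [Measure.smul_apply, smul_eq_mul, ENNReal.ofReal_mul (by positivity)]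
  gcongr

/-- Under the spike-and-slab prior the sparsity is at most the drawn size, so its tail is bounded
by the tail of the prior on sizes. -/
theorem spikeSlab_sparsity_gt_le (π : ℕ → ℝ) (hπ : ∀ s, 0 ≤ π s) {r : ℝ} (hr : 0 < r) (R : ℝ) :
    spikeSlab p π r {θ | R < sparsity θ} ≤
      ENNReal.ofReal (∑ s ∈ Finset.range (p + 1) with R < (s : ℕ), π s) := by
  have := isProbabilityMeasure_slab (p := p) hr
  have hle : ∀ S : Finset (Fin p),
      Measure.pi (fun j => if j ∈ S then laplaceMeasure r else Measure.dirac 0)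
        {θ : Fin p → ℝ | R < sparsity θ} ≤ if R < (S.card : ℝ) then 1 else 0 := fun S => by
    split_ifs with h
    · exact prob_le_one
    · refine le_of_eq ((measure_eq_zero_iff_ae_notMem).2 ?_)
      have h0 : ∀ᵐ θ ∂Measure.pi (fun j => if j ∈ S then laplaceMeasure r else Measure.dirac 0),
          ∀ j, j ∉ S → θ j = 0 := by
        rw [ae_all_iff]
        intro j
        by_cases hj : j ∈ S
        · exact ae_of_all _ fun θ hj' => absurd hj hj'
        · refine (Measure.tendsto_eval_ae_ae (i := j)).eventually (p := fun x => j ∉ S → x = 0) ?_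
          rw [if_neg hj]
          simp [ae_dirac_eq]
      filter_upwards [h0] with θ hθ hR
      refine h (hR.trans_le ?_)
      rw [sparsity_eq_card]
      gcongr
      intro j hj
      by_contra hjS
      exact (Finset.mem_filter.1 hj).2 (hθ j hjS)
  calc spikeSlab p π r {θ | R < sparsity θ}
      ≤ ∑ S : Finset (Fin p), ENNReal.ofReal (π S.card / (p.choose S.card : ℝ)) *
          (if R < (S.card : ℝ) then 1 else 0) := by
        rw [spikeSlab, Measure.coe_finsetSum, Finset.sum_apply]
        refine Finset.sum_le_sum fun S _ => ?_
        rw [Measure.smul_apply, smul_eq_mul]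
        gcongr
        exact hle S
    _ = ENNReal.ofReal (∑ S : Finset (Fin p), if R < (S.card : ℝ) then
          π S.card / (p.choose S.card : ℝ) else 0) := by
        rw [ENNReal.ofReal_sum_of_nonneg]
        · refine Finset.sum_congr rfl fun S _ => ?_
          split_ifs <;> simp
        · intro S _
          have := hπ S.card
          split_ifs <;> positivity
    _ = _ := by
        congr 1
        have h := Finset.sum_powerset_apply_card
          (f := fun s => if R < (s : ℝ) then π s / (p.choose s : ℝ) else 0)
          (x := (Finset.univ : Finset (Fin p)))
        rw [Finset.powerset_univ] at h
        rw [h, Finset.card_univ, Fintype.card_fin, Finset.sum_filter]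
        refine Finset.sum_congr rfl fun s hs => ?_
        have : (p.choose s : ℝ) ≠ 0 := by
          exact_mod_cast (Nat.choose_pos (Nat.lt_succ_iff.1 (Finset.mem_range.1 hs))).ne'
        split_ifs
        · rw [nsmul_eq_mul]; field_simp
        · simp

theorem sizePrior_add_le {π : ℕ → ℝ} {q : ℝ} (hq0 : 0 ≤ q)
    (hstep : ∀ s, 1 ≤ s → s ≤ p → π s ≤ q * π (s - 1)) (t k : ℕ) (h : t + k ≤ p) :
    π (t + k) ≤ q ^ k * π t := by
  induction k with
  | zero => simp
  | succ k ih =>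
    calc π (t + (k + 1)) ≤ q * π (t + k) := hstep (t + (k + 1)) (by omega) h
      _ ≤ q * (q ^ k * π t) := by gcongr; exact ih (by omega)
      _ = _ := by ring

/-- Geometric decay from `s₀` on: the tail of the size prior above `R ≥ s₀` is at most twice the
bound `q ^ (R - s₀) π(s₀)` for its first term. -/
theorem sizePrior_tail_le {π : ℕ → ℝ} (hπ : ∀ s, 0 ≤ π s) {q : ℝ} (hq0 : 0 < q) (hq : q ≤ 1 / 2)
    (hstep : ∀ s, 1 ≤ s → s ≤ p → π s ≤ q * π (s - 1)) {s₀ : ℕ} {R : ℝ} (hR : s₀ ≤ R) :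
    ∑ s ∈ Finset.range (p + 1) with R < (s : ℕ), π s ≤ 2 * (q ^ (R - s₀) * π s₀) := by
  have hR0 : 0 ≤ R := (Nat.cast_nonneg _).trans hR
  set t := ⌊R⌋₊ + 1 with ht
  have htR : R ≤ t := by
    rw [ht]; push_cast; exact (Nat.lt_floor_add_one R).le
  have hst : s₀ ≤ t := by exact_mod_cast hR.trans htR
  have hsub : (Finset.range (p + 1)).filter (fun s : ℕ => R < s) ⊆ Finset.Ico t (p + 1) := by
    intro s hs
    rw [Finset.mem_filter, Finset.mem_range] at hs
    exact Finset.mem_Ico.2 ⟨(Nat.floor_lt hR0).2 hs.2, hs.1⟩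
  calc ∑ s ∈ Finset.range (p + 1) with R < (s : ℕ), π s
      ≤ ∑ s ∈ Finset.Ico t (p + 1), π s :=
        Finset.sum_le_sum_of_subset_of_nonneg hsub fun s _ _ => hπ s
    _ = ∑ k ∈ Finset.range (p + 1 - t), π (t + k) := Finset.sum_Ico_eq_sum_range _ _ _
    _ ≤ ∑ k ∈ Finset.range (p + 1 - t), (1 / 2) ^ k * (q ^ (R - s₀) * π s₀) := by
        refine Finset.sum_le_sum fun k hk => ?_
        rw [Finset.mem_range] at hk
        have h1 : π t ≤ q ^ (R - s₀) * π s₀ := by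
          have h2 := sizePrior_add_le hq0.le hstep s₀ (t - s₀) (by omega)
          rw [Nat.add_sub_cancel' hst] at h2
          refine h2.trans ?_
          have := hπ s₀
          gcongr
          rw [← Real.rpow_natCast, Nat.cast_sub hst]
          exact Real.rpow_le_rpow_of_exponent_ge hq0 (by linarith) (by linarith)
        calc π (t + k) ≤ q ^ k * π t := sizePrior_add_le hq0.le hstep t k (by omega)
          _ ≤ _ := by
            have := hπ t
            gcongr
    _ = (∑ k ∈ Finset.range (p + 1 - t), (1 / 2 : ℝ) ^ k) * (q ^ (R - s₀) * π s₀) := by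
        rw [Finset.sum_mul]
    _ ≤ _ := by
        have := hπ s₀
        gcongr
        exact sum_geometric_two_le _

/-- Neighbouring sizes have comparable prior masses, so that none of them can vanish. -/
theorem sizePrior_pos {π : ℕ → ℝ} (hπ : ∀ s, 0 ≤ π s)
    (hsum : ∑ s ∈ Finset.range (p + 1), π s = 1) {q l : ℝ} (hq : 0 ≤ q) (hl : 0 < l)
    (hup : ∀ s, 1 ≤ s → s ≤ p → π s ≤ q * π (s - 1))
    (hlow : ∀ s, 1 ≤ s → s ≤ p → l * π (s - 1) ≤ π s) {s : ℕ} (hs : s ≤ p) : 0 < π s := by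
  have h0 : 0 < π 0 := by
    refine lt_of_le_of_ne (hπ 0) fun h => ?_
    have : ∀ s ∈ Finset.range (p + 1), π s = 0 := fun s hs => by
      have h1 := sizePrior_add_le hq hup 0 s (by rw [Finset.mem_range] at hs; omega)
      rw [← h, mul_zero, zero_add] at h1
      exact le_antisymm h1 (hπ s)
    rw [Finset.sum_eq_zero this] at hsum
    exact zero_ne_one hsum
  induction s with
  | zero => exact h0
  | succ s ih => exact (mul_pos hl (ih (by omega))).trans_le (hlow (s + 1) (by omega) hs)

end Prior

/-! ### Prediction error and the design matrix -/

section Design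

variable {n : ℕ} {ℍ : Type*} [MeasurableSpace ℍ] (M : Model n ℍ)

theorem Model.sum_sq_col_le (j : Fin M.p) : ∑ i, ∑ k, M.X i k j ^ 2 ≤ M.colNorm ^ 2 := by
  have h : √(∑ i, ∑ k, M.X i k j ^ 2) ≤ M.colNorm :=
    le_ciSup (f := fun j : Fin M.p => √(∑ i, ∑ k, M.X i k j ^ 2)) (Set.finite_range _).bddAbove j
  exact (Real.sqrt_le_iff.1 h).2

/-- `‖X (θ - θ₀)‖ ≤ ‖X‖_* ‖θ - θ₀‖₁`, squared. -/
theorem Model.predSq_le (θ θ₀ : M.Coef) :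
    M.predSq θ θ₀ ≤ (∑ j, |θ j - θ₀ j|) ^ 2 * M.colNorm ^ 2 := by
  set u : M.Coef := θ - θ₀ with hu
  have h1 : ∀ i k, ((M.X i).mulVec u) k ^ 2 ≤ (∑ j, |u j|) * ∑ j, |u j| * M.X i k j ^ 2 :=
    fun i k => by
      refine Finset.sum_sq_le_sum_mul_sum_of_sq_le_mul Finset.univ (r := fun j => M.X i k j * u j)
        (f := fun j => |u j|) (g := fun j => |u j| * M.X i k j ^ 2) (fun j _ => abs_nonneg _)
        (fun j _ => by positivity) fun j _ => le_of_eq ?_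
      rw [mul_pow, ← sq_abs (u j)]
      ring
  calc M.predSq θ θ₀ ≤ ∑ i, ∑ k, (∑ j, |u j|) * ∑ j, |u j| * M.X i k j ^ 2 :=
        Finset.sum_le_sum fun i _ => Finset.sum_le_sum fun k _ => h1 i k
    _ = (∑ j, |u j|) * ∑ j, |u j| * ∑ i, ∑ k, M.X i k j ^ 2 := by
        simp only [← Finset.mul_sum]
        congr 1
        simp only [Finset.mul_sum]
        rw [Finset.sum_comm]
        rw [Finset.sum_congr rfl fun i _ => Finset.sum_comm]
    _ ≤ (∑ j, |u j|) * ∑ j, |u j| * M.colNorm ^ 2 := by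
        gcongr
        exact M.sum_sq_col_le _
    _ = _ := by
        rw [← Finset.sum_mul]
        simp only [hu, Pi.sub_apply]
        ring

theorem Model.measurable_predSq (θ₀ : M.Coef) : Measurable fun θ => M.predSq θ θ₀ := by
  unfold Model.predSq
  simp only [Matrix.mulVec, dotProduct, Pi.sub_apply]
  fun_prop

theorem Model.measurable_d (η₀ : ℍ) : Measurable fun η => M.d η η₀ := by
  unfold Model.d Model.dASq Model.dBSq frobSq
  simp only [Matrix.sub_apply]
  have h1 := M.measurable_ξ
  have h2 := M.measurable_Δ
  fun_prop

end Design

/-! ### Prior and posterior mass at a fixed sample size -/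

section Concentration

theorem Prior.isFiniteMeasure_joint {p : ℕ} {ℍ : Type*} [MeasurableSpace ℍ] (Q : Prior p ℍ) :
    IsFiniteMeasure Q.joint := by
  have := Q.isProb
  have := isFiniteMeasure_spikeSlab (p := p) Q.π Q.lam_pos
  unfold Prior.joint
  infer_instance

variable {n : ℕ} {ℍ : Type*} [MeasurableSpace ℍ] (M : Model n ℍ) (Q : Prior M.p ℍ)

/-- Prior mass of the coefficients with a prediction error at most `r`, where `r ≥ 1`. -/
theorem le_spikeSlab_predSq_le {L₁ L₂ D r : ℝ} (hL₁ : 0 < L₁) (hL₂ : 0 < L₂)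
    (hlam : M.colNorm / (L₁ * (M.p : ℝ) ^ L₂) ≤ Q.lam) (θ₀ : M.Coef)
    (hθ₀ : ∀ j, |θ₀ j| ≤ D * (Q.lam⁻¹ * Real.log M.p)) (hr : 1 ≤ r) (hp : 2 ≤ M.p) :
    ENNReal.ofReal (Q.π (sparsity θ₀) *
      Real.exp (-((2 + D + L₂ + (1 + Real.log (max L₁ 1)) / Real.log 2) *
        (sparsity θ₀ * Real.log M.p)))) ≤
      spikeSlab M.p Q.π Q.lam {θ | M.predSq θ θ₀ ≤ r} := by
  set s₀ := sparsity θ₀ with hs₀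
  set l := max L₁ 1 with hl
  have hl1 : 1 ≤ l := le_max_right _ _
  have hl0 : 0 < l := by linarith
  have hpR : (2 : ℝ) ≤ M.p := by exact_mod_cast hp
  have hp0 : (0 : ℝ) < M.p := by linarith
  have hlam0 := Q.lam_pos
  have hs₀p : s₀ ≤ M.p := sparsity_le θ₀
  have hlog2 : 0 < Real.log 2 := Real.log_pos one_lt_two
  have hlogp : Real.log 2 ≤ Real.log M.p := Real.log_le_log two_pos hpR
  have hpow : 0 < (M.p : ℝ) ^ L₂ := Real.rpow_pos_of_pos hp0 _
  have hpow1 : 1 ≤ (M.p : ℝ) ^ L₂ := Real.one_le_rpow (by linarith) hL₂.le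
  have hcol0 : 0 ≤ M.colNorm := Real.iSup_nonneg fun j => Real.sqrt_nonneg _
  -- The box has half-width `ρ / λ`, small enough to absorb both `‖X‖_*` and the sum over `j`.
  set ρ : ℝ := (M.p * (l * (M.p : ℝ) ^ L₂))⁻¹ with hρ
  have hρ0 : 0 < ρ := by positivity
  have hρ1 : ρ ≤ 1 := by
    refine inv_le_one_of_one_le₀ ?_
    nlinarith [mul_le_mul hl1 hpow1 zero_le_one hl0.le]
  have hcard : ((Finset.univ.filter fun j => θ₀ j ≠ 0).card : ℝ) = s₀ := by
    rw [hs₀, sparsity_eq_card]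
  have hsub : {θ | ∀ j, |θ j - θ₀ j| ≤ if θ₀ j ≠ 0 then ρ / Q.lam else 0} ⊆
      {θ | M.predSq θ θ₀ ≤ r} := by
    intro θ hθ
    have h1 : ∑ j, |θ j - θ₀ j| ≤ M.p * (ρ / Q.lam) := by
      calc ∑ j, |θ j - θ₀ j| ≤ ∑ j, if θ₀ j ≠ 0 then ρ / Q.lam else 0 :=
            Finset.sum_le_sum fun j _ => hθ j
        _ = s₀ * (ρ / Q.lam) := by
            rw [← Finset.sum_filter, Finset.sum_const, nsmul_eq_mul, hcard]
        _ ≤ _ := by gcongr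
    have h2 : M.colNorm ≤ Q.lam * (l * (M.p : ℝ) ^ L₂) := by
      rw [div_le_iff₀ (by positivity)] at hlam
      refine hlam.trans ?_
      gcongr
      exact le_max_left _ _
    have h3 : (∑ j, |θ j - θ₀ j|) * M.colNorm ≤ 1 := by
      calc (∑ j, |θ j - θ₀ j|) * M.colNorm
          ≤ (M.p * (ρ / Q.lam)) * (Q.lam * (l * (M.p : ℝ) ^ L₂)) := by gcongr
        _ = 1 := by rw [hρ]; field_simp
    have h4 : 0 ≤ (∑ j, |θ j - θ₀ j|) * M.colNorm :=
      mul_nonneg (Finset.sum_nonneg fun _ _ => abs_nonneg _) hcol0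
    calc M.predSq θ θ₀ ≤ ((∑ j, |θ j - θ₀ j|) * M.colNorm) ^ 2 := by
          rw [mul_pow]; exact M.predSq_le θ θ₀
      _ ≤ 1 := pow_le_one₀ h4 h3
      _ ≤ r := hr
  refine le_trans ?_ ((le_spikeSlab_box Q.π Q.lam_pos hρ0.le θ₀ (Q.π_nonneg _)).trans
    (measure_mono hsub))
  apply ENNReal.ofReal_le_ofReal
  have hπ := Q.π_nonneg s₀
  have hchoose : ((M.p.choose s₀ : ℕ) : ℝ) ≤ Real.exp (s₀ * Real.log M.p) := by
    calc ((M.p.choose s₀ : ℕ) : ℝ) ≤ (M.p : ℝ) ^ s₀ := by exact_mod_cast Nat.choose_le_pow _ _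
      _ = _ := by rw [Real.exp_nat_mul, Real.exp_log hp0]
  have hchoose0 : (0 : ℝ) < M.p.choose s₀ := by exact_mod_cast Nat.choose_pos hs₀p
  have hρexp : ρ = Real.exp (-(Real.log M.p + (Real.log l + L₂ * Real.log M.p))) := by
    rw [Real.exp_neg, Real.exp_add, Real.exp_add, Real.exp_log hp0, Real.exp_log hl0,
      mul_comm L₂, ← Real.rpow_def_of_pos hp0]
  have hprod : Real.exp (-(s₀ * ((1 + L₂ + D) * Real.log M.p + (1 + Real.log l)))) ≤
      ∏ j with θ₀ j ≠ 0, ρ * Real.exp (-(Q.lam * |θ₀ j|) - ρ) := by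
    have h1 : Real.exp (-(s₀ * ((1 + L₂ + D) * Real.log M.p + (1 + Real.log l)))) =
        ∏ j with θ₀ j ≠ 0, Real.exp (-((1 + L₂ + D) * Real.log M.p + (1 + Real.log l))) := by
      rw [Finset.prod_const, ← Real.exp_nat_mul, hcard]
      ring_nf
    rw [h1]
    refine Finset.prod_le_prod (fun _ _ => (Real.exp_pos _).le) fun j _ => ?_
    have h2 : Q.lam * |θ₀ j| ≤ D * Real.log M.p := by
      calc Q.lam * |θ₀ j| ≤ Q.lam * (D * (Q.lam⁻¹ * Real.log M.p)) := by gcongr; exact hθ₀ j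
        _ = _ := by field_simp
    nth_rw 1 [hρexp]
    rw [← Real.exp_add]
    apply Real.exp_le_exp.2
    linarith
  have hl_log : 0 ≤ 1 + Real.log l := by linarith [Real.log_nonneg hl1]
  calc _ ≤ Q.π s₀ * (Real.exp (-(s₀ * Real.log M.p)) *
        Real.exp (-(s₀ * ((1 + L₂ + D) * Real.log M.p + (1 + Real.log l))))) := by
        rw [← Real.exp_add]
        gcongr
        have h1 : 1 + Real.log l ≤ (1 + Real.log l) / Real.log 2 * Real.log M.p := by
          rw [div_mul_eq_mul_div, le_div_iff₀ hlog2]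
          gcongr
        have h2 : (s₀ : ℝ) * (1 + Real.log l) ≤
            s₀ * ((1 + Real.log l) / Real.log 2 * Real.log M.p) := by gcongr
        linarith
    _ ≤ Q.π s₀ * ((M.p.choose s₀ : ℝ)⁻¹ *
        ∏ j with θ₀ j ≠ 0, ρ * Real.exp (-(Q.lam * |θ₀ j|) - ρ)) := by
        gcongr
        rw [Real.exp_neg]
        gcongr
    _ = _ := by ring

/-- If the prior gives coefficients of sparsity above `R` exponentially less mass than it gives
to a neighbourhood of the truth, then the expected posterior mass of such coefficients is
exponentially small. -/
theorem lintegral_posterior_sparsity_gt_le {c E C L e R : ℝ} (θ₀ : M.Coef) (η₀ : ℍ) (hc : 0 < c)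
    (heig : ∀ i k, c ≤ (M.posDef η₀ i).1.eigenvalues k)
    (hnear : ∀ η ∈ Q.H, M.d η η₀ ≤ e → ∀ i, c⁻¹ ^ 2 * frobSq (M.Δ η i - M.Δ η₀ i) ≤ 1 / 16)
    (hL : n * e ^ 2 ≤ L) {π₀ : ℝ} (hπ₀ : 0 < π₀)
    (hθ : ENNReal.ofReal (π₀ * Real.exp (-(E * L))) ≤
      spikeSlab M.p Q.π Q.lam {θ | M.predSq θ θ₀ ≤ n * e ^ 2})
    (hη : Real.exp (-(C * L)) ≤ Q.nuisance.real {η | η ∈ Q.H ∧ M.d η η₀ ≤ e})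
    (hT : spikeSlab M.p Q.π Q.lam {θ | R < sparsity θ} ≤
      ENNReal.ofReal (2 * (π₀ * Real.exp (-((E + C + (8 * c⁻¹ + c⁻¹ ^ 2) + 2) * L))))) :
    ∫⁻ y, posterior M Q y {t | R < (sparsity t.1 : ℝ)} ∂M.law θ₀ η₀ ≤
      ENNReal.ofReal (6 * Real.exp (-L)) := by
  have hprob := Q.isProb
  have hfin := Q.isFiniteMeasure_joint
  have := isFiniteMeasure_spikeSlab (p := M.p) Q.π Q.lam_pos
  set C₂ := 8 * c⁻¹ + c⁻¹ ^ 2 with hC₂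
  set B₁ : Set M.Coef := {θ | M.predSq θ θ₀ ≤ n * e ^ 2}
  set B₂ : Set ℍ := {η | M.d η η₀ ≤ e}
  have hB₁ : MeasurableSet B₁ := measurableSet_le (M.measurable_predSq θ₀) measurable_const
  have hB₂ : MeasurableSet B₂ := measurableSet_le (M.measurable_d η₀) measurable_const
  have hTm : MeasurableSet {θ : M.Coef | R < (sparsity θ : ℝ)} :=
    measurableSet_lt measurable_const measurable_sparsity
  have hTeq : {t : M.Coef × ℍ | R < (sparsity t.1 : ℝ)} =
      {θ : M.Coef | R < (sparsity θ : ℝ)} ×ˢ Set.univ := by ext; simp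
  have hTmass : Q.joint {t : M.Coef × ℍ | R < (sparsity t.1 : ℝ)} ≤
      ENNReal.ofReal (2 * (π₀ * Real.exp (-((E + C + C₂ + 2) * L)))) := by
    rw [hTeq, Prior.joint, Measure.prod_prod, measure_univ, mul_one]
    exact hT
  have hBmass : ENNReal.ofReal (π₀ * Real.exp (-((E + C) * L))) ≤ Q.joint (B₁ ×ˢ B₂) := by
    rw [Prior.joint, Measure.prod_prod]
    calc ENNReal.ofReal (π₀ * Real.exp (-((E + C) * L)))
        = ENNReal.ofReal (π₀ * Real.exp (-(E * L))) * ENNReal.ofReal (Real.exp (-(C * L))) := by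
          rw [← ENNReal.ofReal_mul (by positivity), mul_assoc, ← Real.exp_add]
          ring_nf
      _ ≤ _ := by
          gcongr
          refine (ENNReal.ofReal_le_ofReal hη).trans ?_
          rw [ofReal_measureReal]
          exact measure_mono fun η h => h.2
  have hB0 : Q.joint (B₁ ×ˢ B₂) ≠ 0 :=
    (lt_of_lt_of_le (ENNReal.ofReal_pos.2 (by positivity)) hBmass).ne'
  have hX : ∀ᵐ t ∂Q.joint, t ∈ B₁ ×ˢ B₂ → ∫⁻ y, ENNReal.ofReal (M.density θ₀ η₀ y) ^ 2 /
      ENNReal.ofReal (M.density t.1 t.2 y) ≤ ENNReal.ofReal (Real.exp (C₂ * L)) := by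
    -- `Q.H` need not be measurable, hence it enters through almost every `η` and not through `B₂`.
    have hH : ∀ᵐ t ∂Q.joint, t.2 ∈ Q.H :=
      (Measure.quasiMeasurePreserving_snd (μ := spikeSlab M.p Q.π Q.lam)
        (ν := Q.nuisance)).ae Q.carried
    filter_upwards [hH] with t ht htB
    have hd : M.d t.2 η₀ ≤ e := htB.2
    have hd2 : n * (M.dASq t.2 η₀ + M.dBSq t.2 η₀) ≤ n * e ^ 2 := by
      gcongr
      exact (Real.sqrt_le_iff.1 hd).2
    refine (M.lintegral_density_sq_div_le hc θ₀ t.1 η₀ t.2 heig (hnear t.2 ht hd) htB.1 hd2).trans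
      (ENNReal.ofReal_le_ofReal (Real.exp_le_exp.2 ?_))
    gcongr
  -- This threshold balances the two terms of `lintegral_posterior_le`.
  set t₀ := π₀⁻¹ * Real.exp ((E + C + C₂ + 1) * L) with ht₀
  have ht₀0 : 0 < t₀ := by positivity
  have hmain := lintegral_posterior_le (Pr := Q.joint) (ν := (volume : Measure M.Obs))
    (p := fun t y => ENNReal.ofReal (M.density t.1 t.2 y))
    (M.measurable_density.ennreal_ofReal)
    (fun t y => (ENNReal.ofReal_pos.2 (M.density_pos _ _ _)).ne') (fun _ _ => ENNReal.ofReal_ne_top)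
    (fun t => (M.lintegral_density t.1 t.2).le)
    (p₀ := fun y => ENNReal.ofReal (M.density θ₀ η₀ y))
    (M.measurable_density.comp (measurable_prodMk_left (x := (θ₀, η₀)))).ennreal_ofReal
    (fun _ => ENNReal.ofReal_ne_top)
    (T := {t : M.Coef × ℍ | R < (sparsity t.1 : ℝ)}) (hB₁.prod hB₂) hB0 (measure_ne_top _ _) hX
    (ENNReal.ofReal_pos.2 ht₀0).ne' ENNReal.ofReal_ne_top
  refine (lintegral_law_posterior_le M θ₀ η₀ (hTeq ▸ hTm.prod MeasurableSet.univ)).trans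
    (hmain.trans ?_)
  calc _ ≤ ENNReal.ofReal t₀ * ENNReal.ofReal (2 * (π₀ * Real.exp (-((E + C + C₂ + 2) * L)))) +
        4 * ((ENNReal.ofReal t₀)⁻¹ * (ENNReal.ofReal (π₀ * Real.exp (-((E + C) * L))))⁻¹ *
          ENNReal.ofReal (Real.exp (C₂ * L))) := by gcongr
    _ = ENNReal.ofReal (t₀ * (2 * (π₀ * Real.exp (-((E + C + C₂ + 2) * L)))) +
        4 * (t₀⁻¹ * (π₀ * Real.exp (-((E + C) * L)))⁻¹ * Real.exp (C₂ * L))) := by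
      rw [← ENNReal.ofReal_inv_of_pos ht₀0, ← ENNReal.ofReal_inv_of_pos (by positivity),
        ← ENNReal.ofReal_mul ht₀0.le, ← ENNReal.ofReal_mul (by positivity),
        ← ENNReal.ofReal_mul (by positivity), ENNReal.ofReal_add (by positivity) (by positivity),
        ENNReal.ofReal_mul (p := 4) (by norm_num)]
      norm_num
    _ = _ := by
      congr 1
      have e1 : t₀ * (2 * (π₀ * Real.exp (-((E + C + C₂ + 2) * L)))) = 2 * Real.exp (-L) := by
        rw [ht₀, show -L = (E + C + C₂ + 1) * L + -((E + C + C₂ + 2) * L) by ring, Real.exp_add]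
        field_simp
      have e2 : t₀⁻¹ * (π₀ * Real.exp (-((E + C) * L)))⁻¹ * Real.exp (C₂ * L) = Real.exp (-L) := by
        rw [ht₀, mul_inv, mul_inv, inv_inv, ← Real.exp_neg, ← Real.exp_neg,
          show -L = -((E + C + C₂ + 1) * L) + - -((E + C) * L) + C₂ * L by ring, Real.exp_add,
          Real.exp_add]
        field_simp
      rw [e1, e2]
      ring

end Concentration

/-! ### Uniform closeness of the covariance matrices -/

section Asymptotics

theorem frobSq_nonneg {k l : ℕ} (A : Matrix (Fin k) (Fin l) ℝ) : 0 ≤ frobSq A := by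
  unfold frobSq
  positivity

theorem frobSq_sub_le {k l : ℕ} (A B C : Matrix (Fin k) (Fin l) ℝ) :
    frobSq (A - C) ≤ 2 * frobSq (A - B) + 2 * frobSq (C - B) := by
  unfold frobSq
  simp only [Finset.mul_sum, ← Finset.sum_add_distrib, Matrix.sub_apply]
  refine Finset.sum_le_sum fun i _ => Finset.sum_le_sum fun j _ => ?_
  nlinarith [sq_nonneg ((A i j - B i j) + (C i j - B i j))]

variable {n : ℕ} {ℍ : Type*} [MeasurableSpace ℍ] (M : Model n ℍ)

theorem Model.frobSq_le_iSup (η₁ η₂ : ℍ) (i : Fin n) : frobSq (M.Δ η₁ i - M.Δ η₂ i) ≤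
    ⨆ i : Fin n, frobSq (M.Δ η₁ i - M.Δ η₂ i) :=
  le_ciSup (f := fun i : Fin n => frobSq (M.Δ η₁ i - M.Δ η₂ i)) (Set.finite_range _).bddAbove i

theorem Model.dBSq_le_iSup (hn : 1 ≤ n) (η₁ η₂ : ℍ) :
    M.dBSq η₁ η₂ ≤ ⨆ i : Fin n, frobSq (M.Δ η₁ i - M.Δ η₂ i) := by
  have hn0 : (0 : ℝ) < n := by exact_mod_cast hn
  unfold Model.dBSq
  rw [one_div, inv_mul_le_iff₀ hn0]
  refine (Finset.sum_le_sum fun i _ => M.frobSq_le_iSup η₁ η₂ i).trans_eq ?_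
  simp

theorem Model.dBSq_le (η₁ η₂ η₃ : ℍ) :
    M.dBSq η₁ η₃ ≤ 2 * M.dBSq η₁ η₂ + 2 * M.dBSq η₃ η₂ := by
  unfold Model.dBSq
  calc _ ≤ (1 / n : ℝ) * ∑ i, (2 * frobSq (M.Δ η₁ i - M.Δ η₂ i) +
        2 * frobSq (M.Δ η₃ i - M.Δ η₂ i)) := by
        gcongr
        exact frobSq_sub_le _ _ _
    _ = _ := by rw [Finset.sum_add_distrib, ← Finset.mul_sum, ← Finset.mul_sum]; ring

theorem Model.dBSq_le_sq_of_d_le {η η₀ : ℍ} {e : ℝ} (h : M.d η η₀ ≤ e) : M.dBSq η η₀ ≤ e ^ 2 := by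
  have h1 := (Real.sqrt_le_iff.1 h).2
  have h2 : 0 ≤ M.dASq η η₀ := by unfold Model.dASq; positivity
  linarith

/-- The covariance condition turns closeness in `d_n` into uniform closeness of the covariance
matrices, through the reference point `η'`. -/
theorem Model.frobSq_le_of_d_le (hn : 1 ≤ n) {a e : ℝ} (ha : 0 ≤ a) {η η' η₀ : ℍ}
    (h : (⨆ i : Fin n, frobSq (M.Δ η i - M.Δ η' i)) ≤ a * M.dBSq η η') (hd : M.d η η₀ ≤ e)
    (i : Fin n) :
    frobSq (M.Δ η i - M.Δ η₀ i) ≤ 4 * (a * e ^ 2) +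
      4 * (a * ⨆ i : Fin n, frobSq (M.Δ η' i - M.Δ η₀ i)) +
      2 * ⨆ i : Fin n, frobSq (M.Δ η' i - M.Δ η₀ i) := by
  set b := ⨆ i : Fin n, frobSq (M.Δ η' i - M.Δ η₀ i) with hb
  have hsymm : frobSq (M.Δ η₀ i - M.Δ η' i) = frobSq (M.Δ η' i - M.Δ η₀ i) := by
    unfold frobSq
    simp only [Matrix.sub_apply]
    exact Finset.sum_congr rfl fun _ _ => Finset.sum_congr rfl fun _ _ => by ring
  have h1 := frobSq_sub_le (M.Δ η i) (M.Δ η' i) (M.Δ η₀ i)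
  have h2 : frobSq (M.Δ η' i - M.Δ η₀ i) ≤ b := M.frobSq_le_iSup η' η₀ i
  have h3 := (M.frobSq_le_iSup η η' i).trans h
  have h4 : M.dBSq η η' ≤ 2 * e ^ 2 + 2 * b := by
    have := M.dBSq_le η η₀ η'
    have := M.dBSq_le_sq_of_d_le hd
    have : M.dBSq η' η₀ ≤ b := M.dBSq_le_iSup hn η' η₀
    linarith
  have h5 : a * M.dBSq η η' ≤ a * (2 * e ^ 2 + 2 * b) := by gcongr
  rw [hsymm] at h1
  linarith

theorem eventually_frobSq_le {ℍ : ℕ → Type*} [∀ n, MeasurableSpace (ℍ n)]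
    {M : ∀ n, Model n (ℍ n)} {Q : ∀ n, Prior (M n).p (ℍ n)} {η₀ : ∀ n, ℍ n} {a ε : ℕ → ℝ}
    (hcov : CovarianceControl M Q η₀ a) (hε : Tendsto (fun n => a n * ε n ^ 2) atTop (𝓝 0))
    {δ : ℝ} (hδ : 0 < δ) :
    ∀ᶠ n in atTop, ∀ η ∈ (Q n).H, (M n).d η (η₀ n) ≤ ε n → ∀ i,
      frobSq ((M n).Δ η i - (M n).Δ (η₀ n) i) ≤ δ := by
  obtain ⟨hapos, hamono, -, ⟨η', hη'H, hη'⟩, hsup⟩ := hcov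
  set b : ℕ → ℝ := fun n => ⨆ i : Fin n, frobSq ((M n).Δ (η' n) i - (M n).Δ (η₀ n) i)
  have ha1 := hapos 1 le_rfl
  have hlim : Tendsto (fun n => 4 * (a n * ε n ^ 2) + 4 * (a n * b n) +
      2 * ((a 1)⁻¹ * (a n * b n))) atTop (𝓝 0) := by
    have := ((hε.const_mul 4).add (hη'.const_mul 4)).add ((hη'.const_mul (a 1)⁻¹).const_mul 2)
    simpa using this
  filter_upwards [hlim.eventually (gt_mem_nhds hδ), eventually_ge_atTop 1] with n hn h1 η hη hd i
  refine le_trans ?_ hn.le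
  refine ((M n).frobSq_le_of_d_le h1 (hapos n h1).le (hsup n h1 η hη _ (hη'H n h1)) hd i).trans ?_
  have hb0 : 0 ≤ b n := Real.iSup_nonneg fun i => frobSq_nonneg _
  have hb : b n ≤ (a 1)⁻¹ * (a n * b n) := by
    rw [le_inv_mul_iff₀ ha1]
    have := hamono (Set.mem_Ici.2 le_rfl) (Set.mem_Ici.2 h1) h1
    gcongr
  change 4 * (a n * ε n ^ 2) + 4 * (a n * b n) + 2 * b n ≤ _
  linarith

end Asymptotics

end SparseGaussian

open SparseGaussian in
theorem theorem1 {ℍ : ℕ → Type*} [∀ n, MeasurableSpace (ℍ n)]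
    (M : ∀ n, SparseGaussian.Model n (ℍ n))
    (Q : ∀ n, SparseGaussian.Prior (M n).p (ℍ n))
    (θ₀ : ∀ n, (M n).Coef) (η₀ : ∀ n, ℍ n) (a ε : ℕ → ℝ)
    (hsize : SparseGaussian.SizePriorDecay M Q)
    (hlam : SparseGaussian.LaplaceRange M Q)
    (hcov : SparseGaussian.CovarianceControl M Q η₀ a)
    (hconc : SparseGaussian.PriorConcentration M Q η₀ a ε)
    (hsignal : SparseGaussian.SignalBound M Q θ₀)
    (heig : SparseGaussian.EigenvalueBound M η₀) :
    ∃ K₁ > (0 : ℝ),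
      Tendsto
        (fun n => ∫⁻ y, SparseGaussian.posterior (M n) (Q n) y
            {t | K₁ * SparseGaussian.sStar M θ₀ ε n < (SparseGaussian.sparsity t.1 : ℝ)}
          ∂(M n).law (θ₀ n) (η₀ n))
        atTop (𝓝 0) := by
  obtain ⟨A₁, hA₁, A₂, hA₂, A₃, hA₃, A₄, hA₄, hstep⟩ := hsize
  obtain ⟨L₁, hL₁, L₂, hL₂, L₃, hL₃, hlam⟩ := hlam
  obtain ⟨haε, hnε, C, hC, hmass⟩ := hconc
  obtain ⟨D, hD, hsignal⟩ := hsignal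
  obtain ⟨c, hc, _, -, heig⟩ := heig
  set E := 2 + D + L₂ + (1 + Real.log (max L₁ 1)) / Real.log 2 with hE
  have hE0 : 0 ≤ E := by
    have := Real.log_nonneg (le_max_right L₁ 1)
    have := Real.log_pos one_lt_two
    positivity
  set F := E + C + (8 * c⁻¹ + c⁻¹ ^ 2) + 2 with hF
  have hF0 : 0 < F := by positivity
  -- Sizes above `K₁ s_⋆` have prior mass about `p ^ (-(A₄ / 2) (K₁ - 1) s_⋆) = exp (-F s_⋆ log p)`.
  refine ⟨1 + 2 * F / A₄, by positivity, ?_⟩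
  have hp : Tendsto (fun n => ((M n).p : ℝ)) atTop atTop :=
    tendsto_atTop_mono (fun n => by exact_mod_cast (M n).p_gt.le) tendsto_natCast_atTop_atTop
  have hpow : Tendsto (fun n => ((M n).p : ℝ) ^ (-(A₄ / 2))) atTop (𝓝 0) :=
    (tendsto_rpow_neg_atTop (half_pos hA₄)).comp hp
  have hnear := eventually_frobSq_le hcov haε (δ := c ^ 2 / 16) (by positivity)
  have hlim : Tendsto (fun n : ℕ => ENNReal.ofReal (6 * Real.exp (-(n * ε n ^ 2))))
      atTop (𝓝 0) := by
    have h := (Real.tendsto_exp_neg_atTop_nhds_zero.comp hnε).const_mul 6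
    rw [mul_zero] at h
    simpa using ENNReal.tendsto_ofReal h
  refine tendsto_of_tendsto_of_tendsto_of_le_of_le' tendsto_const_nhds hlim
    (Eventually.of_forall fun _ => bot_le) ?_
  filter_upwards [hnear, hpow.eventually (gt_mem_nhds (show (0 : ℝ) < 1 / 2 by norm_num)),
    hpow.eventually (gt_mem_nhds (inv_pos.2 hA₂)), hnε.eventually_ge_atTop 1,
    eventually_ge_atTop 1] with n hnear hq hqA hnε1 hn1
  have hp2 : 2 ≤ (M n).p := by have := (M n).p_gt; omega
  have hp2R : (2 : ℝ) ≤ (M n).p := by exact_mod_cast hp2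
  have hp0 : (0 : ℝ) < (M n).p := by linarith
  have hlogp : 0 < Real.log (M n).p := Real.log_pos (by linarith)
  set s₀ := sparsity (θ₀ n) with hs₀
  set q : ℝ := ((M n).p : ℝ) ^ (-(A₄ / 2)) with hq_def
  have hq0 : 0 < q := Real.rpow_pos_of_pos hp0 _
  set S := sStar M θ₀ ε n with hS
  set L := S * Real.log (M n).p with hL
  have hSs : (s₀ : ℝ) ≤ S := le_max_left _ _
  have hS0 : 0 ≤ S := (Nat.cast_nonneg _).trans hSs
  have hLs : s₀ * Real.log (M n).p ≤ L := mul_le_mul_of_nonneg_right hSs hlogp.le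
  have hLε : n * ε n ^ 2 ≤ L := by
    rw [hL, ← div_le_iff₀ hlogp]
    exact le_max_right _ _
  have hup : ∀ s, 1 ≤ s → s ≤ (M n).p → (Q n).π s ≤ q * (Q n).π (s - 1) := fun s h1 h2 => by
    refine (hstep n hn1 s h1 h2).2.trans ?_
    have := (Q n).π_nonneg (s - 1)
    gcongr
    -- `A₂ p^(-A₄) = (A₂ q) q`, and `A₂ q ≤ 1` for large `n`.
    have h3 : ((M n).p : ℝ) ^ (-A₄) = q * q := by
      rw [hq_def, ← Real.rpow_add hp0]
      ring_nf
    have h4 : A₂ * q ≤ 1 := by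
      calc A₂ * q ≤ A₂ * A₂⁻¹ := by gcongr
        _ = 1 := mul_inv_cancel₀ hA₂.ne'
    calc A₂ * ((M n).p : ℝ) ^ (-A₄) = (A₂ * q) * q := by rw [h3]; ring
      _ ≤ 1 * q := by gcongr
      _ = q := one_mul q
  have hπ₀ : 0 < (Q n).π s₀ :=
    sizePrior_pos (Q n).π_nonneg (Q n).π_sum hq0.le
      (mul_pos hA₁ (Real.rpow_pos_of_pos hp0 (-A₃))) hup
      (fun s h1 h2 => (hstep n hn1 s h1 h2).1) (sparsity_le _)
  have hKS : (s₀ : ℝ) ≤ (1 + 2 * F / A₄) * S := by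
    have : 0 ≤ 2 * F / A₄ * S := by positivity
    linarith
  refine (lintegral_posterior_sparsity_gt_le (M n) (Q n) (E := E) (C := C) (L := L) (e := ε n)
    (θ₀ n) (η₀ n) hc (fun i k => (heig n hn1 i k).1) ?_ hLε hπ₀ ?_ ?_ ?_).trans ?_
  · intro η hη hd i
    calc c⁻¹ ^ 2 * frobSq ((M n).Δ η i - (M n).Δ (η₀ n) i) ≤ c⁻¹ ^ 2 * (c ^ 2 / 16) := by
          gcongr
          exact hnear η hη hd i
      _ = 1 / 16 := by field_simp
  · refine le_trans ?_ (le_spikeSlab_predSq_le (M n) (Q n) hL₁ hL₂ (hlam n hn1).1 (θ₀ n)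
      (hsignal n hn1) hnε1 hp2)
    gcongr
  · refine le_trans (Real.exp_le_exp.2 ?_) (hmass n hn1)
    rw [neg_mul]
    gcongr
  · refine (spikeSlab_sparsity_gt_le _ (Q n).π_nonneg (Q n).lam_pos _).trans
      (ENNReal.ofReal_le_ofReal ((sizePrior_tail_le (Q n).π_nonneg hq0 hq.le hup hKS).trans ?_))
    rw [mul_comm ((Q n).π s₀)]
    gcongr
    rw [hq_def, ← Real.rpow_mul hp0.le, Real.rpow_def_of_pos hp0]
    apply Real.exp_le_exp.2
    have h1 : F * L = A₄ / 2 * (2 * F / A₄ * S) * Real.log (M n).p := by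
      rw [hL]; field_simp
    have h2 : A₄ / 2 * (2 * F / A₄ * S) * Real.log (M n).p ≤
        A₄ / 2 * ((1 + 2 * F / A₄) * S - s₀) * Real.log (M n).p := by
      gcongr
      linarith
    linarith
  · apply ENNReal.ofReal_le_ofReal
    gcongr
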